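/- Let $n\ge 3$, $m\ge 1$, $\varepsilon_1,\dots,\varepsilon_n\in\{1,-1\}$, and let $(\mathbb{R}^n,g)$, $g_{ij}=\delta_{ij}\varepsilon_i$, be the pseudo-Euclidean space. Let $(F,g_F)$ be a nonempty $m$-dimensional smooth pseudo-Riemannian manifold of constant scalar curvature $\lambda_F\in\mathbb{R}$. Let $\alpha=(\alpha_1,\dots,\alpha_n)\in\mathbb{R}^n\setminus\{0\}$, put $\xi(x)=\sum_{k}\alpha_k x_k$, and let $f,\varphi,h:\mathbb{R}\to\mathbb{R}$ be smooth functions with $f>0$ and $\varphi$ nowhere zero, regarded as the functions $f(\xi)$, $\varphi(\xi)$, $h(\xi)$ on $\mathbb{R}^n$. Let $\rho\in\mathbb{R}$, and let $\tilde g=\varphi(\xi)^{-2}g\oplus f(\xi)^2g_F$ be the warped product metric on $M=\mathbb{R}^n\times F$. Call $\tilde g$ a gradient Yamabe soliton with potential function $h$ (and constant $\rho$) if $(S_{\tilde g}-\rho)\,\tilde g=\mathrm{Hess}_{\tilde g}(h)$ on $M$, where $S_{\tilde g}$ is the scalar curvature and $h$ stands for $(x,y)\mapsto h(\xi(x))$.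 (a) If $\sum_{k}\varepsilon_k\alpha_k^2=\varepsilon_{k_0}$ for some $k_0$, then $\tilde g$ is a gradient Yamabe soliton with potential function $h$ and constant $\rho$ if and only if, on $\mathbb{R}$, $$h''+2\frac{\varphi'h'}{\varphi}=0,$$ $$\varepsilon_{k_0}\Big[(n-1)\big(2\varphi\varphi''-n(\varphi')^2\big)-2\frac{m}{f}\big(\varphi^2f''-(n-2)\varphi\varphi'f'\big)-\frac{m(m-1)}{f^2}\varphi^2(f')^2+\varphi'h'\varphi\Big]=\rho-\frac{\lambda_F}{f^2},$$ $$\varepsilon_{k_0}\Big[(n-1)\big(2\varphi\varphi''-n(\varphi')^2\big)-2\frac{m}{f}\big(\varphi^2f''-(n-2)\varphi\varphi'f'\big)-\frac{m(m-1)}{f^2}\varphi^2(f')^2-\frac{\varphi^2}{f}f'h'\Big]=\rho-\frac{\lambda_F}{f^2}.$$ (b) If $\sum_{k}\varepsilon_k\alpha_k^2=0$, then $\tilde g$ is a gradient Yamabe soliton with potential function $h$ and constant $\rho$ if and only if, on $\mathbb{R}$, $$h''+2\frac{\varphi'h'}{\varphi}=0\qquad\text{and}\qquad \rho-\frac{\lambda_F}{f^2}=0.$$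 -/

import Mathlib

open scoped Manifold ContDiff

noncomputable section

namespace WarpedYamabe

/-! ### Tensor calculus in coordinates

`E` is the coordinate space, `b` a basis of it (the coordinate directions), `G : E → Matrix ι ι ℝ`
the matrix `g_{ij}` of a metric in these coordinates. -/

section Coordinates

variable {ι E : Type*} [Fintype ι] [DecidableEq ι] [NormedAddCommGroup E] [NormedSpace ℝ E]

/-- The partial derivative `∂_i u` at `z`. -/
def partialDeriv (b : Module.Basis ι ℝ E) (i : ι) (u : E → ℝ) (z : E) : ℝ :=
  fderiv ℝ u z (b i)

/-- The Christoffel symbol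
`Γ^k_{ij} = (1/2) ∑_l g^{kl} (∂_i g_{jl} + ∂_j g_{il} - ∂_l g_{ij})`. -/
def christoffel (b : Module.Basis ι ℝ E) (G : E → Matrix ι ι ℝ) (k i j : ι) (z : E) : ℝ :=
  (1 / 2) * ∑ l, (G z)⁻¹ k l *
    (partialDeriv b i (fun y => G y j l) z + partialDeriv b j (fun y => G y i l) z
      - partialDeriv b l (fun y => G y i j) z)

/-- The Ricci tensor, the trace over `i` of `X ↦ R(X, ∂_j)∂_k`:
`Ric_{jk} = ∑_i (∂_i Γ^i_{jk} - ∂_j Γ^i_{ik} + ∑_l (Γ^i_{il} Γ^l_{jk} - Γ^i_{jl} Γ^l_{ik}))`. -/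
def ricciCoord (b : Module.Basis ι ℝ E) (G : E → Matrix ι ι ℝ) (j k : ι) (z : E) : ℝ :=
  ∑ i, (partialDeriv b i (christoffel b G i j k) z - partialDeriv b j (christoffel b G i i k) z
    + ∑ l, (christoffel b G i i l z * christoffel b G l j k z
        - christoffel b G i j l z * christoffel b G l i k z))

/-- The scalar curvature `∑_{j,k} g^{jk} Ric_{jk}`. -/
def scalarCoord (b : Module.Basis ι ℝ E) (G : E → Matrix ι ι ℝ) (z : E) : ℝ :=
  ∑ j, ∑ k, (G z)⁻¹ j k * ricciCoord b G j k z

/-- The Hessian `∂_i ∂_j u - ∑_k Γ^k_{ij} ∂_k u`. -/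
def hessCoord (b : Module.Basis ι ℝ E) (G : E → Matrix ι ι ℝ) (u : E → ℝ) (i j : ι) (z : E) : ℝ :=
  partialDeriv b i (partialDeriv b j u) z
    - ∑ k, christoffel b G k i j z * partialDeriv b k u z

end Coordinates

/-! ### Pseudo-Riemannian manifolds

All manifolds below are without boundary. -/

/-- A field of bilinear forms on the tangent spaces of `M`. -/
abbrev TensorField {E H : Type*} [NormedAddCommGroup E] [NormedSpace ℝ E] [TopologicalSpace H]
    (I : ModelWithCorners ℝ E H) (M : Type*) [TopologicalSpace M] [ChartedSpace H M] :=
  ∀ p : M, LinearMap.BilinForm ℝ (TangentSpace I p)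

section Manifold

variable {ι E H : Type*} [Fintype ι] [DecidableEq ι] [NormedAddCommGroup E] [NormedSpace ℝ E]
  [TopologicalSpace H] {I : ModelWithCorners ℝ E H}
  {M : Type*} [TopologicalSpace M] [ChartedSpace H M]

/-- The coordinate vector field `∂_i` of the chart around `p`, at the point with coordinates `z`. -/
def coordVector (I : ModelWithCorners ℝ E H) (b : Module.Basis ι ℝ E) (p : M) (i : ι) (z : E) :
    TangentSpace I ((extChartAt I p).symm z) :=
  mfderiv 𝓘(ℝ, E) I (extChartAt I p).symm z (b i)

/-- The matrix `g_{ij} = g(∂_i, ∂_j)` of `g` in the chart around `p`. -/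
def metricCoord (b : Module.Basis ι ℝ E) (g : TensorField I M) (p : M) (z : E) : Matrix ι ι ℝ :=
  Matrix.of fun i j =>
    g ((extChartAt I p).symm z) (coordVector I b p i z) (coordVector I b p j z)

/-- `g` is a pseudo-Riemannian metric: symmetric, nondegenerate, and with smooth components
`g_{ij}` in the charts of the manifold. -/
structure IsPseudoRiemannianMetric (b : Module.Basis ι ℝ E) (g : TensorField I M) : Prop where
  symm : ∀ p, (g p).IsSymm
  nondegenerate : ∀ p, (g p).Nondegenerate
  smooth : ∀ (p : M) (i j : ι),
    ContDiffOn ℝ ∞ (fun z => metricCoord b g p z i j) (extChartAt I p).target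

/-- The scalar curvature `S_g` at `p`, computed in the chart around `p`
(it depends neither on the chart nor on the basis `b`). -/
def scalarCurvature (b : Module.Basis ι ℝ E) (g : TensorField I M) (p : M) : ℝ :=
  scalarCoord b (metricCoord b g p) (extChartAt I p p)

/-- The component `Hess_g(u)(∂_i, ∂_j)` at `p` of the Hessian of `u`, in the chart around `p`. -/
def hessian (b : Module.Basis ι ℝ E) (g : TensorField I M) (u : M → ℝ) (p : M) (i j : ι) : ℝ :=
  hessCoord b (metricCoord b g p) (fun z => u ((extChartAt I p).symm z)) i j (extChartAt I p p)

/-- `(M, g)` is a gradient Yamabe soliton with potential function `u` and constant `ρ`: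
`g` is a pseudo-Riemannian metric, `u` is smooth and `(S_g - ρ) g = Hess_g(u)`. -/
structure IsGradientYamabeSoliton (b : Module.Basis ι ℝ E) (g : TensorField I M) (u : M → ℝ)
    (ρ : ℝ) : Prop where
  metric : IsPseudoRiemannianMetric b g
  smooth : ContMDiff I 𝓘(ℝ, ℝ) ∞ u
  equation : ∀ (p : M) (i j : ι),
    (scalarCurvature b g p - ρ) * metricCoord b g p (extChartAt I p p) i j = hessian b g u p i j

end Manifold

/-- The warped product metric `π^* g_B + (f ∘ π)² σ^* g_F` on `B × F`, where `π` and `σ` are the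
projections of `B × F` to `B` and `F`. -/
def warpedMetric {E H E' H' : Type*} [NormedAddCommGroup E] [NormedSpace ℝ E] [TopologicalSpace H]
    [NormedAddCommGroup E'] [NormedSpace ℝ E'] [TopologicalSpace H']
    {I : ModelWithCorners ℝ E H} {J : ModelWithCorners ℝ E' H'}
    {B : Type*} [TopologicalSpace B] [ChartedSpace H B]
    {F : Type*} [TopologicalSpace F] [ChartedSpace H' F]
    (gB : TensorField I B) (f : B → ℝ) (gF : TensorField J F) : TensorField (I.prod J) (B × F) :=
  fun p =>
    (gB p.1).comp (mfderiv (I.prod J) I Prod.fst p).toLinearMap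
        (mfderiv (I.prod J) I Prod.fst p).toLinearMap
      + (f p.1) ^ 2 • (gF p.2).comp (mfderiv (I.prod J) J Prod.snd p).toLinearMap
        (mfderiv (I.prod J) J Prod.snd p).toLinearMap

/-- The metric `φ^{-2} g` on `ℝⁿ` conformal to the pseudo-Euclidean metric `g_{ij} = δ_{ij} ε_i`. -/
def conformalMetric {n : ℕ} (ε : Fin n → ℝ) (φ : EuclideanSpace ℝ (Fin n) → ℝ) :
    TensorField (𝓡 n) (EuclideanSpace ℝ (Fin n)) :=
  fun x => (LinearMap.mk₂ ℝ (fun v w => 1 / φ x ^ 2 * ∑ i, ε i * (v i * w i))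
    (fun u v w => by simp only [PiLp.add_apply, add_mul, mul_add, Finset.sum_add_distrib])
    (fun c v w => by
      simp only [PiLp.smul_apply, smul_eq_mul, Finset.mul_sum]
      exact Finset.sum_congr rfl fun i _ => by ring)
    (fun u v w => by simp only [PiLp.add_apply, mul_add, Finset.sum_add_distrib])
    (fun c v w => by
      simp only [PiLp.smul_apply, smul_eq_mul, Finset.mul_sum]
      exact Finset.sum_congr rfl fun i _ => by ring) :
    LinearMap.BilinForm ℝ (EuclideanSpace ℝ (Fin n)))

/-- The standard basis of `ℝⁿ`. -/
abbrev stdBasis (n : ℕ) : Module.Basis (Fin n) ℝ (EuclideanSpace ℝ (Fin n)) :=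
  (EuclideanSpace.basisFun (Fin n) ℝ).toBasis

/-- The basic invariant `ξ = ∑ α_k x_k` of a translation group. -/
def xi {n : ℕ} (α : Fin n → ℝ) (x : EuclideanSpace ℝ (Fin n)) : ℝ :=
  ∑ k, α k * x k

end WarpedYamabe

end

open WarpedYamabe

/-!
Everything is local: in the product chart around `(x, y)` the metric has the block form
`diag(ε_i / φ(ξ)²) ⊕ f(ξ)² B(w)`, where `B` is the matrix of `g_F` in the chart around `y`
(`metricCoord_warpedMetric`). This shape is recorded in the structure `IsWarpedCoord`, for which the
tensor calculus is carried out.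

With `α_i = ∂_i ξ` and `N = ∑ ε_i α_i²`, each Christoffel symbol is a constant tensor or a function
of `w`, times a function of `ξ`: those with indices along `ℝⁿ` are `-(φ' / φ)` times
`conformalTensor`, the mixed ones are `Γ^c_{ia} = δ_{ac} α_i f' / f` and
`Γ^k_{ac} = -φ² f f' ε_k α_k B_{ac}`, and those along the fibre are the symbols of `B`. The
contractions of `conformalTensor` then give the Ricci tensor, the scalar curvature
(`IsWarpedCoord.scalarCoord_eq`)
`S = N [(n - 1)(2φφ'' - nφ'²) - (2m/f)(φ²f'' - (n - 2)φφ'f') - m(m - 1)φ²f'²/f²] + S_F / f²`,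
and the Hessian of `h(ξ)`, which is
`α_i α_j (h'' + 2φ'h'/φ) - δ_{ij} ε_i (φ'h'/φ) N` along `ℝⁿ`, `0` on mixed indices, and
`N φ² f f' h' B_{ac}` along the fibre.

The mixed components of the soliton equation are trivial. Since `n ≥ 2`, the tensors `α ⊗ α` and
`diag(ε)` are not proportional, so the block along `ℝⁿ` splits into `h'' + 2φ'h'/φ = 0` and
`S - ρ = -N φφ'h'` (`forall_smul_diagonal_eq_iff`). Since `B ≠ 0`, the block along the fibre says
`S - ρ = N φ² f'h'/f`. This is the system of `isGradientYamabeSoliton_iff`; the two parts of the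
theorem are the cases `N = ε_{k₀}` and `N = 0`.
-/

open scoped Topology

noncomputable section

namespace WarpedYamabe

open Sum

/-! ### Partial derivatives of products `u(ξ) v(w)` -/

section ProductCoordinates

variable {ι κ E₁ E₂ : Type*} [NormedAddCommGroup E₁] [NormedSpace ℝ E₁]
  [NormedAddCommGroup E₂] [NormedSpace ℝ E₂] (b₁ : Module.Basis ι ℝ E₁) (b₂ : Module.Basis κ ℝ E₂)
  (ξ : E₁ →L[ℝ] ℝ)

theorem partialDeriv_congr {ι E : Type*} [NormedAddCommGroup E] [NormedSpace ℝ E]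
    (b : Module.Basis ι ℝ E) (i : ι) {u v : E → ℝ} {z : E} (huv : u =ᶠ[𝓝 z] v) :
    partialDeriv b i u z = partialDeriv b i v z := by
  rw [partialDeriv, huv.fderiv_eq, partialDeriv]

theorem hasFDerivAt_profile_mul {u : ℝ → ℝ} {v : E₂ → ℝ} {u' : ℝ} {z : E₁ × E₂}
    (hu : HasDerivAt u u' (ξ z.1)) (hv : DifferentiableAt ℝ v z.2) :
    HasFDerivAt (fun y : E₁ × E₂ => u (ξ y.1) * v y.2)
      (u (ξ z.1) • (fderiv ℝ v z.2).comp (ContinuousLinearMap.snd ℝ E₁ E₂)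
        + v z.2 • (u' • ξ.comp (ContinuousLinearMap.fst ℝ E₁ E₂))) z := by
  have h1 : HasFDerivAt (fun y : E₁ × E₂ => ξ y.1)
      (ξ.comp (ContinuousLinearMap.fst ℝ E₁ E₂)) z :=
    (ξ.comp (ContinuousLinearMap.fst ℝ E₁ E₂)).hasFDerivAt
  have h2 : HasFDerivAt (fun y : E₁ × E₂ => v y.2)
      ((fderiv ℝ v z.2).comp (ContinuousLinearMap.snd ℝ E₁ E₂)) z :=
    HasFDerivAt.comp z (f := Prod.snd) hv.hasFDerivAt (hasFDerivAt_snd)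
  exact (hu.comp_hasFDerivAt z h1).mul h2

theorem partialDeriv_inl_of_eventuallyEq {F : E₁ × E₂ → ℝ} {u : ℝ → ℝ} {v : E₂ → ℝ} {u' : ℝ}
    {z : E₁ × E₂} (i : ι) (hF : F =ᶠ[𝓝 z] fun y => u (ξ y.1) * v y.2)
    (hu : HasDerivAt u u' (ξ z.1)) (hv : DifferentiableAt ℝ v z.2) :
    partialDeriv (b₁.prod b₂) (inl i) F z = ξ (b₁ i) * u' * v z.2 := by
  rw [partialDeriv_congr _ _ hF, partialDeriv, (hasFDerivAt_profile_mul ξ hu hv).fderiv]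
  simp
  ring

theorem partialDeriv_inr_of_eventuallyEq {F : E₁ × E₂ → ℝ} {u : ℝ → ℝ} {v : E₂ → ℝ} {u' : ℝ}
    {z : E₁ × E₂} (a : κ) (hF : F =ᶠ[𝓝 z] fun y => u (ξ y.1) * v y.2)
    (hu : HasDerivAt u u' (ξ z.1)) (hv : DifferentiableAt ℝ v z.2) :
    partialDeriv (b₁.prod b₂) (inr a) F z = u (ξ z.1) * partialDeriv b₂ a v z.2 := by
  rw [partialDeriv_congr _ _ hF, partialDeriv, (hasFDerivAt_profile_mul ξ hu hv).fderiv]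
  simp [partialDeriv]

/-- Differentiability of `v` is not needed: if `v` is not differentiable at `z.2`, then `v ∘ snd`
is not differentiable at `z`, and both sides are `0`. -/
theorem partialDeriv_inr_comp_snd (v : E₂ → ℝ) (a : κ) (z : E₁ × E₂) :
    partialDeriv (b₁.prod b₂) (inr a) (fun y => v y.2) z = partialDeriv b₂ a v z.2 := by
  by_cases hv : DifferentiableAt ℝ v z.2
  · have h := partialDeriv_inr_of_eventuallyEq b₁ b₂ 0 (u := fun _ => 1) (F := fun y => v y.2) a
      (.of_forall fun y => by simp) (hasDerivAt_const _ _) hv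
    simpa using h
  · have hv' : ¬ DifferentiableAt ℝ (fun y : E₁ × E₂ => v y.2) z := fun h => hv <| by
      have h2 : DifferentiableAt ℝ (fun w : E₂ => (z.1, w)) z.2 := by fun_prop
      exact DifferentiableAt.comp z.2 (g := fun y : E₁ × E₂ => v y.2) (f := fun w => (z.1, w)) h h2
    rw [partialDeriv, partialDeriv, fderiv_zero_of_not_differentiableAt hv,
      fderiv_zero_of_not_differentiableAt hv']
    simp

theorem partialDeriv_inl_profile {F : E₁ × E₂ → ℝ} {u : ℝ → ℝ} {u' : ℝ}
    {z : E₁ × E₂} (i : ι) (hF : F =ᶠ[𝓝 z] fun y => u (ξ y.1))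
    (hu : HasDerivAt u u' (ξ z.1)) :
    partialDeriv (b₁.prod b₂) (inl i) F z = ξ (b₁ i) * u' := by
  simpa using partialDeriv_inl_of_eventuallyEq b₁ b₂ ξ (v := fun _ => 1) i
    (hF.trans (.of_forall fun y => by simp)) hu (by fun_prop)

theorem partialDeriv_inr_profile {F : E₁ × E₂ → ℝ} {u : ℝ → ℝ} {u' : ℝ}
    {z : E₁ × E₂} (a : κ) (hF : F =ᶠ[𝓝 z] fun y => u (ξ y.1))
    (hu : HasDerivAt u u' (ξ z.1)) :
    partialDeriv (b₁.prod b₂) (inr a) F z = 0 := by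
  simpa [partialDeriv] using partialDeriv_inr_of_eventuallyEq b₁ b₂ ξ (v := fun _ => 1) a
    (hF.trans (.of_forall fun y => by simp)) hu (by fun_prop)

theorem partialDeriv_inl_potential {h : ℝ → ℝ} (hh : ContDiff ℝ ∞ h) (i : ι) (z : E₁ × E₂) :
    partialDeriv (b₁.prod b₂) (inl i) (fun y => h (ξ y.1)) z = ξ (b₁ i) * deriv h (ξ z.1) :=
  partialDeriv_inl_profile b₁ b₂ ξ i .rfl (hh.differentiable (by simp) _).hasDerivAt

theorem partialDeriv_inr_potential {h : ℝ → ℝ} (hh : ContDiff ℝ ∞ h) (a : κ) (z : E₁ × E₂) :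
    partialDeriv (b₁.prod b₂) (inr a) (fun y => h (ξ y.1)) z = 0 :=
  partialDeriv_inr_profile b₁ b₂ ξ a .rfl (hh.differentiable (by simp) _).hasDerivAt

theorem partialDeriv_zero {ι E : Type*} [NormedAddCommGroup E] [NormedSpace ℝ E]
    (b : Module.Basis ι ℝ E) (i : ι) {u : E → ℝ} {z : E} (hu : u =ᶠ[𝓝 z] fun _ => 0) :
    partialDeriv b i u z = 0 := by
  rw [partialDeriv_congr _ _ hu, partialDeriv]; simp

end ProductCoordinates

/-! ### Christoffel symbols of a warped product in coordinates -/

section WarpedCoordinates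

variable {ι κ E₁ E₂ : Type*} [DecidableEq ι] [Fintype κ] [DecidableEq κ]
  [NormedAddCommGroup E₁] [NormedSpace ℝ E₁] [NormedAddCommGroup E₂] [NormedSpace ℝ E₂]

/-- The tensor `δ^k_j α_i + δ^k_i α_j - g_{ij} g^{kl} α_l` with `g_{ij} = δ_{ij} ε_i`: up to the factor
`-φ' / φ` these are the Christoffel symbols of `φ(ξ)^{-2} g`, where `α_i = ∂_i ξ`. -/
def conformalTensor (ε α : ι → ℝ) (k i j : ι) : ℝ :=
  (if j = k then α i else 0) + (if i = k then α j else 0)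
    - if i = j then ε i * ε k * α k else 0

theorem sum_mul_conformalTensor [Fintype ι] (ε α : ι → ℝ) (j k : ι) :
    ∑ i, α i * conformalTensor ε α i j k
      = 2 * α j * α k - if j = k then ε j * ∑ i, ε i * α i ^ 2 else 0 := by
  simp only [conformalTensor, mul_add, mul_sub, mul_ite, mul_zero, Finset.sum_add_distrib,
    Finset.sum_sub_distrib, Finset.sum_ite_eq, Finset.mem_univ, if_true]
  split_ifs with h
  · rw [Finset.mul_sum]
    have : ∀ x, α x * (ε j * ε x * α x) = ε j * (ε x * α x ^ 2) := fun x => by ring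
    simp only [this]
    ring
  · simp; ring

theorem sum_conformalTensor_self [Fintype ι] {ε : ι → ℝ} (hε : ∀ i, ε i * ε i = 1) (α : ι → ℝ)
    (k : ι) : ∑ i, conformalTensor ε α i i k = Fintype.card ι * α k := by
  simp [conformalTensor, hε, Finset.sum_add_distrib]

/-- The contraction `∑_{i,l} Γ^i_{jl} Γ^l_{ik}` of the Ricci tensor, for `conformalTensor`. -/
theorem sum_conformalTensor_mul [Fintype ι] {ε : ι → ℝ} (hε : ∀ i, ε i * ε i = 1) (α : ι → ℝ)
    (j k : ι) :
    ∑ i, ∑ l, conformalTensor ε α i j l * conformalTensor ε α l i k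
      = (Fintype.card ι + 2) * α j * α k
        - 2 * if j = k then ε j * ∑ i, ε i * α i ^ 2 else 0 := by
  have key : ∀ i, ∑ l, conformalTensor ε α i j l * conformalTensor ε α l i k
      = α j * conformalTensor ε α i i k
        + (if j = i then ∑ l, α l * conformalTensor ε α l j k else 0)
        - ε j * ε i * α i * conformalTensor ε α j i k := by
    intro i
    conv_lhs => enter [2, l, 1]; rw [conformalTensor]
    simp only [add_mul, sub_mul, ite_mul, zero_mul, Finset.sum_add_distrib,
      Finset.sum_sub_distrib, Finset.sum_ite_eq, Finset.sum_ite_eq', Finset.mem_univ, if_true]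
    split_ifs with h
    · subst h; rfl
    · simp
  have key₂ : ∑ i, ε j * ε i * α i * conformalTensor ε α j i k
      = if j = k then ε j * ∑ i, ε i * α i ^ 2 else 0 := by
    simp only [conformalTensor, mul_add, mul_sub, mul_ite, mul_zero, Finset.sum_add_distrib,
      Finset.sum_sub_distrib, Finset.sum_ite_eq', Finset.mem_univ, if_true]
    have h1 : ε j * ε k * α k * (ε k * ε j * α j) = α j * α k := by
      linear_combination (α j * α k * (ε k * ε k)) * hε j + α j * α k * hε k
    rw [h1, hε]
    by_cases h : j = k
    · subst h
      simp only [if_true, Finset.mul_sum]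
      have : ∀ x, ε j * ε x * α x * α x = ε j * (ε x * α x ^ 2) := fun x => by ring
      simp only [this]
      ring
    · simp [h, Ne.symm h, mul_comm]
  simp only [key, Finset.sum_add_distrib, Finset.sum_sub_distrib, key₂, ← Finset.mul_sum,
    sum_conformalTensor_self hε, Finset.sum_ite_eq, Finset.mem_univ, if_true,
    sum_mul_conformalTensor]
  ring

/-- For coordinates `z = (x, w)` in `E₁ × E₂` with `w ∈ U`, the matrix `G z` is
`diag(ε_i / φ(ξ x)²) ⊕ f(ξ x)² B(w)`, with signs `ε_i`, smooth nowhere zero profiles `φ` and `f`, and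
a differentiable field `B` of invertible symmetric matrices. The set `U` is the target of a chart of
the fibre; nothing is asked of `G` outside `E₁ × U`. -/
structure IsWarpedCoord (ξ : E₁ →L[ℝ] ℝ) (ε : ι → ℝ) (φ f : ℝ → ℝ) (B : E₂ → Matrix κ κ ℝ)
    (U : Set E₂) (G : E₁ × E₂ → Matrix (ι ⊕ κ) (ι ⊕ κ) ℝ) : Prop where
  sign : ∀ i, ε i = 1 ∨ ε i = -1
  smooth_conf : ContDiff ℝ ∞ φ
  smooth_warp : ContDiff ℝ ∞ f
  conf_ne : ∀ t, φ t ≠ 0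
  warp_ne : ∀ t, f t ≠ 0
  isOpen : IsOpen U
  symm : ∀ w a c, B w a c = B w c a
  isUnit : ∀ w ∈ U, IsUnit (B w)
  diff : ∀ w ∈ U, ∀ a c, DifferentiableAt ℝ (fun w => B w a c) w
  eq : ∀ z : E₁ × E₂, z.2 ∈ U → G z = Matrix.fromBlocks
    (Matrix.diagonal fun i => ε i / φ (ξ z.1) ^ 2) 0 0 (f (ξ z.1) ^ 2 • B z.2)

namespace IsWarpedCoord

variable {ξ : E₁ →L[ℝ] ℝ} {ε : ι → ℝ} {φ f : ℝ → ℝ} {B : E₂ → Matrix κ κ ℝ}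
  {U : Set E₂} {G : E₁ × E₂ → Matrix (ι ⊕ κ) (ι ⊕ κ) ℝ} {z : E₁ × E₂}
  (b₁ : Module.Basis ι ℝ E₁) (b₂ : Module.Basis κ ℝ E₂)

theorem eventually_mem (hG : IsWarpedCoord ξ ε φ f B U G) (hz : z.2 ∈ U) :
    ∀ᶠ y in 𝓝 z, y.2 ∈ U :=
  (hG.isOpen.preimage continuous_snd).mem_nhds hz

theorem sign_mul_self (hG : IsWarpedCoord ξ ε φ f B U G) (i : ι) : ε i * ε i = 1 := by
  rcases hG.sign i with h | h <;> simp [h]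

theorem sign_sq (hG : IsWarpedCoord ξ ε φ f B U G) (i : ι) : ε i ^ 2 = 1 := by
  rw [pow_two, hG.sign_mul_self]

theorem hasDerivAt_conf (hG : IsWarpedCoord ξ ε φ f B U G) (t : ℝ) :
    HasDerivAt φ (deriv φ t) t :=
  (hG.smooth_conf.differentiable (by simp) t).hasDerivAt

theorem hasDerivAt_warp (hG : IsWarpedCoord ξ ε φ f B U G) (t : ℝ) :
    HasDerivAt f (deriv f t) t :=
  (hG.smooth_warp.differentiable (by simp) t).hasDerivAt

theorem hasDerivAt_deriv_conf (hG : IsWarpedCoord ξ ε φ f B U G) (t : ℝ) :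
    HasDerivAt (deriv φ) (deriv (deriv φ) t) t :=
  (((contDiff_infty_iff_deriv.1 hG.smooth_conf).2).differentiable (by simp) t).hasDerivAt

theorem hasDerivAt_deriv_warp (hG : IsWarpedCoord ξ ε φ f B U G) (t : ℝ) :
    HasDerivAt (deriv f) (deriv (deriv f) t) t :=
  (((contDiff_infty_iff_deriv.1 hG.smooth_warp).2).differentiable (by simp) t).hasDerivAt

/-- `B⁻¹ B = 1` with the second factor transposed, which is allowed because `B` is symmetric. -/
theorem sum_inv_mul (hG : IsWarpedCoord ξ ε φ f B U G) (hz : z.2 ∈ U) (a c : κ) :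
    ∑ d, (B z.2)⁻¹ c d * B z.2 a d = if a = c then 1 else 0 := by
  have h : (B z.2)⁻¹ * B z.2 = 1 :=
    Matrix.nonsing_inv_mul _ ((Matrix.isUnit_iff_isUnit_det _).1 (hG.isUnit _ hz))
  have h' := congrFun (congrFun h c) a
  rw [Matrix.mul_apply, Matrix.one_apply] at h'
  simp only [hG.symm z.2 a, h', eq_comm]

theorem partialDeriv_inl_inl_inl (hG : IsWarpedCoord ξ ε φ f B U G) (hz : z.2 ∈ U) (i j l : ι) :
    partialDeriv (b₁.prod b₂) (inl i) (fun y => G y (inl j) (inl l)) z =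
      if j = l then -(2 * ε j * ξ (b₁ i) * deriv φ (ξ z.1) / φ (ξ z.1) ^ 3) else 0 := by
  have hφ := hG.conf_ne (ξ z.1)
  split_ifs with h
  · subst h
    have hd : HasDerivAt (fun t => ε j / φ t ^ 2)
        (-(2 * ε j * deriv φ (ξ z.1) / φ (ξ z.1) ^ 3)) (ξ z.1) := by
      refine ((hasDerivAt_const _ (ε j)).div ((hG.hasDerivAt_conf (ξ z.1)).pow 2)
        (pow_ne_zero 2 hφ)).congr_deriv ?_
      simp
      field_simp
    rw [partialDeriv_inl_profile b₁ b₂ ξ i ?_ hd]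
    · ring
    · filter_upwards [hG.eventually_mem hz] with y hy
      simp [hG.eq y hy]
  · refine partialDeriv_zero _ _ ?_
    filter_upwards [hG.eventually_mem hz] with y hy
    simp [hG.eq y hy, h]

theorem partialDeriv_inr_inl_inl (hG : IsWarpedCoord ξ ε φ f B U G) (hz : z.2 ∈ U) (a : κ)
    (j l : ι) : partialDeriv (b₁.prod b₂) (inr a) (fun y => G y (inl j) (inl l)) z = 0 := by
  have hφ := hG.conf_ne (ξ z.1)
  have hd : DifferentiableAt ℝ (fun t => Matrix.diagonal (fun i => ε i / φ t ^ 2) j l) (ξ z.1) := by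
    by_cases h : j = l
    · subst h
      have := hG.hasDerivAt_conf (ξ z.1) |>.differentiableAt
      simp only [Matrix.diagonal_apply_eq]
      fun_prop (disch := simp [hφ])
    · simp [h]
  refine partialDeriv_inr_profile b₁ b₂ ξ a ?_ hd.hasDerivAt
  filter_upwards [hG.eventually_mem hz] with y hy
  simp [hG.eq y hy]

theorem partialDeriv_inl_inr (hG : IsWarpedCoord ξ ε φ f B U G) (hz : z.2 ∈ U) (s : ι ⊕ κ)
    (j : ι) (a : κ) : partialDeriv (b₁.prod b₂) s (fun y => G y (inl j) (inr a)) z = 0 := by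
  refine partialDeriv_zero _ _ ?_
  filter_upwards [hG.eventually_mem hz] with y hy
  simp [hG.eq y hy]

theorem partialDeriv_inr_inl (hG : IsWarpedCoord ξ ε φ f B U G) (hz : z.2 ∈ U) (s : ι ⊕ κ)
    (j : ι) (a : κ) : partialDeriv (b₁.prod b₂) s (fun y => G y (inr a) (inl j)) z = 0 := by
  refine partialDeriv_zero _ _ ?_
  filter_upwards [hG.eventually_mem hz] with y hy
  simp [hG.eq y hy]

theorem partialDeriv_inl_inr_inr (hG : IsWarpedCoord ξ ε φ f B U G) (hz : z.2 ∈ U) (i : ι)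
    (a c : κ) : partialDeriv (b₁.prod b₂) (inl i) (fun y => G y (inr a) (inr c)) z =
      2 * ξ (b₁ i) * f (ξ z.1) * deriv f (ξ z.1) * B z.2 a c := by
  rw [partialDeriv_inl_of_eventuallyEq b₁ b₂ ξ i (u := fun t => f t ^ 2)
    (v := fun w => B w a c) ?_ ((hG.hasDerivAt_warp (ξ z.1)).pow 2) (hG.diff _ hz a c)]
  · simp only [Nat.cast_ofNat, Nat.add_one_sub_one, pow_one]
    ring
  · filter_upwards [hG.eventually_mem hz] with y hy
    simp [hG.eq y hy]

theorem partialDeriv_inr_inr_inr (hG : IsWarpedCoord ξ ε φ f B U G) (hz : z.2 ∈ U) (a c d : κ) :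
    partialDeriv (b₁.prod b₂) (inr a) (fun y => G y (inr c) (inr d)) z =
      f (ξ z.1) ^ 2 * partialDeriv b₂ a (fun w => B w c d) z.2 := by
  rw [partialDeriv_inr_of_eventuallyEq b₁ b₂ ξ a (u := fun t => f t ^ 2)
    (v := fun w => B w c d) ?_ ((hG.hasDerivAt_warp (ξ z.1)).pow 2) (hG.diff _ hz c d)]
  filter_upwards [hG.eventually_mem hz] with y hy
  simp [hG.eq y hy]

variable [Fintype ι]

theorem inv_eq (hG : IsWarpedCoord ξ ε φ f B U G) (hz : z.2 ∈ U) :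
    (G z)⁻¹ = Matrix.fromBlocks (Matrix.diagonal fun i => ε i * φ (ξ z.1) ^ 2) 0 0
      ((f (ξ z.1) ^ 2)⁻¹ • (B z.2)⁻¹) := by
  have hφ := hG.conf_ne (ξ z.1)
  have hf := hG.warp_ne (ξ z.1)
  apply Matrix.inv_eq_right_inv
  rw [hG.eq z hz, Matrix.fromBlocks_multiply]
  have h1 : ∀ i, ε i / φ (ξ z.1) ^ 2 * (ε i * φ (ξ z.1) ^ 2) = 1 := fun i => by
    field_simp
    exact hG.sign_sq i
  have h2 : B z.2 * (B z.2)⁻¹ = 1 :=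
    Matrix.mul_nonsing_inv _ ((Matrix.isUnit_iff_isUnit_det _).1 (hG.isUnit _ hz))
  simp [h1, h2, smul_smul, hf]

theorem christoffel_inl_inl_inl (hG : IsWarpedCoord ξ ε φ f B U G) (hz : z.2 ∈ U) (k i j : ι) :
    christoffel (b₁.prod b₂) G (inl k) (inl i) (inl j) z =
      -(deriv φ (ξ z.1) / φ (ξ z.1)) * conformalTensor ε (fun i => ξ (b₁ i)) k i j := by
  have hφ := hG.conf_ne (ξ z.1)
  have h1 := hG.sign_mul_self k
  simp only [conformalTensor, christoffel, Fintype.sum_sum_type, hG.inv_eq hz,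
    hG.partialDeriv_inl_inl_inl b₁ b₂ hz,
    Matrix.fromBlocks_apply₁₁, Matrix.fromBlocks_apply₁₂, Matrix.zero_apply, zero_mul,
    Finset.sum_const_zero, add_zero, Matrix.diagonal_apply, ite_mul, Finset.sum_ite_eq,
    Finset.mem_univ, if_true]
  by_cases hjk : j = k <;> by_cases hik : i = k <;> by_cases hij : i = j <;>
    simp [hjk, hik, hij] <;> field_simp <;> grind

theorem christoffel_inl_inr_inr (hG : IsWarpedCoord ξ ε φ f B U G) (hz : z.2 ∈ U) (k : ι)
    (a c : κ) : christoffel (b₁.prod b₂) G (inl k) (inr a) (inr c) z =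
      -(φ (ξ z.1) ^ 2 * f (ξ z.1) * deriv f (ξ z.1)) * (ε k * ξ (b₁ k) * B z.2 a c) := by
  simp only [christoffel, Fintype.sum_sum_type, hG.inv_eq hz, hG.partialDeriv_inl_inr_inr b₁ b₂ hz,
    hG.partialDeriv_inr_inl b₁ b₂ hz,
    Matrix.fromBlocks_apply₁₁, Matrix.fromBlocks_apply₁₂, Matrix.zero_apply, zero_mul,
    Finset.sum_const_zero, add_zero, Matrix.diagonal_apply, ite_mul, Finset.sum_ite_eq,
    Finset.mem_univ, if_true]
  ring

theorem christoffel_inl_inl_inr (hG : IsWarpedCoord ξ ε φ f B U G) (hz : z.2 ∈ U) (k i : ι)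
    (a : κ) : christoffel (b₁.prod b₂) G (inl k) (inl i) (inr a) z = 0 := by
  simp [christoffel, Fintype.sum_sum_type, hG.inv_eq hz, hG.partialDeriv_inr_inl_inl b₁ b₂ hz,
    hG.partialDeriv_inr_inl b₁ b₂ hz, hG.partialDeriv_inl_inr b₁ b₂ hz]

theorem christoffel_inl_inr_inl (hG : IsWarpedCoord ξ ε φ f B U G) (hz : z.2 ∈ U) (k i : ι)
    (a : κ) : christoffel (b₁.prod b₂) G (inl k) (inr a) (inl i) z = 0 := by
  simp [christoffel, Fintype.sum_sum_type, hG.inv_eq hz, hG.partialDeriv_inr_inl_inl b₁ b₂ hz,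
    hG.partialDeriv_inr_inl b₁ b₂ hz]

theorem christoffel_inr_inl_inl (hG : IsWarpedCoord ξ ε φ f B U G) (hz : z.2 ∈ U) (c : κ)
    (i j : ι) : christoffel (b₁.prod b₂) G (inr c) (inl i) (inl j) z = 0 := by
  simp [christoffel, Fintype.sum_sum_type, hG.inv_eq hz, hG.partialDeriv_inr_inl_inl b₁ b₂ hz,
    hG.partialDeriv_inl_inr b₁ b₂ hz]

theorem christoffel_inr_inl_inr (hG : IsWarpedCoord ξ ε φ f B U G) (hz : z.2 ∈ U) (c : κ)
    (i : ι) (a : κ) : christoffel (b₁.prod b₂) G (inr c) (inl i) (inr a) z =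
      if a = c then ξ (b₁ i) * (deriv f (ξ z.1) / f (ξ z.1)) else 0 := by
  have hf := hG.warp_ne (ξ z.1)
  simp only [christoffel, Fintype.sum_sum_type, hG.inv_eq hz, hG.partialDeriv_inl_inr b₁ b₂ hz,
    hG.partialDeriv_inl_inr_inr b₁ b₂ hz, Matrix.fromBlocks_apply₂₁, Matrix.fromBlocks_apply₂₂,
    Matrix.zero_apply, zero_mul, Finset.sum_const_zero, zero_add, add_zero, sub_zero,
    Matrix.smul_apply, smul_eq_mul]
  have h := hG.sum_inv_mul hz a c
  calc _ = ξ (b₁ i) * (deriv f (ξ z.1) / f (ξ z.1)) *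
        ∑ d, (B z.2)⁻¹ c d * B z.2 a d := by
        rw [Finset.mul_sum, Finset.mul_sum]
        refine Finset.sum_congr rfl fun d _ => ?_
        field_simp
    _ = _ := by rw [h]; simp

theorem christoffel_inr_inr_inl (hG : IsWarpedCoord ξ ε φ f B U G) (hz : z.2 ∈ U) (c : κ)
    (i : ι) (a : κ) : christoffel (b₁.prod b₂) G (inr c) (inr a) (inl i) z =
      if a = c then ξ (b₁ i) * (deriv f (ξ z.1) / f (ξ z.1)) else 0 := by
  rw [← hG.christoffel_inr_inl_inr b₁ b₂ hz]
  simp only [christoffel, Fintype.sum_sum_type, hG.inv_eq hz, hG.partialDeriv_inl_inr b₁ b₂ hz,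
    hG.partialDeriv_inl_inr_inr b₁ b₂ hz, hG.partialDeriv_inr_inl b₁ b₂ hz,
    Matrix.fromBlocks_apply₂₁, Matrix.zero_apply, zero_mul, zero_add, add_zero]

theorem christoffel_inr_inr_inr (hG : IsWarpedCoord ξ ε φ f B U G) (hz : z.2 ∈ U) (c a d : κ) :
    christoffel (b₁.prod b₂) G (inr c) (inr a) (inr d) z = christoffel b₂ B c a d z.2 := by
  have hf := hG.warp_ne (ξ z.1)
  simp only [christoffel, Fintype.sum_sum_type, hG.inv_eq hz,
    hG.partialDeriv_inr_inr_inr b₁ b₂ hz, Matrix.fromBlocks_apply₂₁, Matrix.fromBlocks_apply₂₂,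
    Matrix.zero_apply, zero_mul, Finset.sum_const_zero, zero_add, Matrix.smul_apply, smul_eq_mul]
  congr 1
  refine Finset.sum_congr rfl fun l _ => ?_
  field_simp

/-! ### Ricci tensor and scalar curvature -/

theorem partialDeriv_christoffel_inl_inl_inl (hG : IsWarpedCoord ξ ε φ f B U G) (hz : z.2 ∈ U)
    (s k i j : ι) :
    partialDeriv (b₁.prod b₂) (inl s) (christoffel (b₁.prod b₂) G (inl k) (inl i) (inl j)) z =
      -((deriv (deriv φ) (ξ z.1) * φ (ξ z.1) - deriv φ (ξ z.1) ^ 2) / φ (ξ z.1) ^ 2)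
        * (ξ (b₁ s) * conformalTensor ε (fun i => ξ (b₁ i)) k i j) := by
  have hφ := hG.conf_ne (ξ z.1)
  have hd := (((hG.hasDerivAt_deriv_conf (ξ z.1)).div (hG.hasDerivAt_conf (ξ z.1)) hφ).neg).mul_const
    (conformalTensor ε (fun i => ξ (b₁ i)) k i j)
  rw [partialDeriv_inl_profile b₁ b₂ ξ s ?_ hd]
  · ring
  · filter_upwards [hG.eventually_mem hz] with y hy
    rw [hG.christoffel_inl_inl_inl b₁ b₂ hy]
    rfl

theorem partialDeriv_christoffel_inl_inr_inr (hG : IsWarpedCoord ξ ε φ f B U G) (hz : z.2 ∈ U)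
    (s k : ι) (a c : κ) :
    partialDeriv (b₁.prod b₂) (inl s) (christoffel (b₁.prod b₂) G (inl k) (inr a) (inr c)) z =
      -(2 * φ (ξ z.1) * deriv φ (ξ z.1) * f (ξ z.1) * deriv f (ξ z.1)
          + φ (ξ z.1) ^ 2 * deriv f (ξ z.1) ^ 2
          + φ (ξ z.1) ^ 2 * f (ξ z.1) * deriv (deriv f) (ξ z.1))
        * (ε k * ξ (b₁ k) * ξ (b₁ s) * B z.2 a c) := by
  have hd := ((((hG.hasDerivAt_conf (ξ z.1)).pow 2).mul (hG.hasDerivAt_warp (ξ z.1))).mul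
    (hG.hasDerivAt_deriv_warp (ξ z.1))).neg.mul_const (ε k * ξ (b₁ k))
  rw [partialDeriv_inl_of_eventuallyEq b₁ b₂ ξ s (v := fun w => B w a c) ?_ hd
    (hG.diff _ hz a c)]
  · simp only [Nat.cast_ofNat, Nat.add_one_sub_one, pow_one, Pi.mul_apply, Pi.pow_apply]
    ring
  · filter_upwards [hG.eventually_mem hz] with y hy
    rw [hG.christoffel_inl_inr_inr b₁ b₂ hy]
    simp only [Pi.mul_apply, Pi.pow_apply, Pi.neg_apply]
    ring

theorem partialDeriv_christoffel_inr_inl_inl (hG : IsWarpedCoord ξ ε φ f B U G) (hz : z.2 ∈ U)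
    (s : ι ⊕ κ) (c : κ) (i j : ι) :
    partialDeriv (b₁.prod b₂) s (christoffel (b₁.prod b₂) G (inr c) (inl i) (inl j)) z = 0 :=
  partialDeriv_zero _ _ ((hG.eventually_mem hz).mono fun _ hy =>
    hG.christoffel_inr_inl_inl b₁ b₂ hy c i j)

theorem partialDeriv_christoffel_inl_inl_inr (hG : IsWarpedCoord ξ ε φ f B U G) (hz : z.2 ∈ U)
    (s : ι ⊕ κ) (k i : ι) (a : κ) :
    partialDeriv (b₁.prod b₂) s (christoffel (b₁.prod b₂) G (inl k) (inl i) (inr a)) z = 0 :=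
  partialDeriv_zero _ _ ((hG.eventually_mem hz).mono fun _ hy =>
    hG.christoffel_inl_inl_inr b₁ b₂ hy k i a)

theorem partialDeriv_christoffel_inr_inr_inl (hG : IsWarpedCoord ξ ε φ f B U G) (hz : z.2 ∈ U)
    (s i : ι) (a : κ) :
    partialDeriv (b₁.prod b₂) (inl s) (christoffel (b₁.prod b₂) G (inr a) (inr a) (inl i)) z =
      (deriv (deriv f) (ξ z.1) * f (ξ z.1) - deriv f (ξ z.1) ^ 2) / f (ξ z.1) ^ 2
        * (ξ (b₁ i) * ξ (b₁ s)) := by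
  have hd := ((hG.hasDerivAt_deriv_warp (ξ z.1)).div (hG.hasDerivAt_warp (ξ z.1))
    (hG.warp_ne _)).const_mul (ξ (b₁ i))
  rw [partialDeriv_inl_profile b₁ b₂ ξ s ?_ hd]
  · ring
  · filter_upwards [hG.eventually_mem hz] with y hy
    rw [hG.christoffel_inr_inr_inl b₁ b₂ hy]
    simp

theorem partialDeriv_christoffel_inr_inr_inr (hG : IsWarpedCoord ξ ε φ f B U G) (hz : z.2 ∈ U)
    (s c a d : κ) :
    partialDeriv (b₁.prod b₂) (inr s) (christoffel (b₁.prod b₂) G (inr c) (inr a) (inr d)) z =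
      partialDeriv b₂ s (christoffel b₂ B c a d) z.2 := by
  rw [← partialDeriv_inr_comp_snd b₁ b₂]
  exact partialDeriv_congr _ _ ((hG.eventually_mem hz).mono fun _ hy =>
    hG.christoffel_inr_inr_inr b₁ b₂ hy c a d)

/-- The letters `p`, `p₁`, `p₂` and `q`, `q₁`, `q₂` stand for `φ`, `f` and their derivatives at
`ξ(z)`. The sum defining the Ricci tensor is split into its parts over `ι` and over `κ`. -/
theorem ricciCoord_inl_inl (hG : IsWarpedCoord ξ ε φ f B U G) (hz : z.2 ∈ U) (j k : ι)
    {p p₁ p₂ q q₁ q₂ n m N : ℝ} (hp : p = φ (ξ z.1)) (hp₁ : p₁ = deriv φ (ξ z.1))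
    (hp₂ : p₂ = deriv (deriv φ) (ξ z.1)) (hq : q = f (ξ z.1)) (hq₁ : q₁ = deriv f (ξ z.1))
    (hq₂ : q₂ = deriv (deriv f) (ξ z.1)) (hn : n = Fintype.card ι) (hm : m = Fintype.card κ)
    (hN : N = ∑ i, ε i * ξ (b₁ i) ^ 2) :
    ricciCoord (b₁.prod b₂) G (inl j) (inl k) z =
      ((n - 2) * p₂ / p - m * q₂ / q - 2 * m * (p₁ / p) * (q₁ / q)) * (ξ (b₁ j) * ξ (b₁ k))
        + if j = k then ε j * N * (p₂ / p - (n - 1) * (p₁ / p) ^ 2 + m * (p₁ / p) * (q₁ / q))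
          else 0 := by
  have hp0 : p ≠ 0 := hp ▸ hG.conf_ne _
  have hq0 : q ≠ 0 := hq ▸ hG.warp_ne _
  have e1 := sum_mul_conformalTensor ε (fun i => ξ (b₁ i)) j k
  have e2 := sum_conformalTensor_self hG.sign_mul_self (fun i => ξ (b₁ i))
  have e3 := sum_conformalTensor_mul hG.sign_mul_self (fun i => ξ (b₁ i)) j k
  have hB : ∑ i, (partialDeriv (b₁.prod b₂) (inl i)
        (christoffel (b₁.prod b₂) G (inl i) (inl j) (inl k)) z
      - partialDeriv (b₁.prod b₂) (inl j)
        (christoffel (b₁.prod b₂) G (inl i) (inl i) (inl k)) z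
      + ∑ l, (christoffel (b₁.prod b₂) G (inl i) (inl i) l z *
            christoffel (b₁.prod b₂) G l (inl j) (inl k) z
          - christoffel (b₁.prod b₂) G (inl i) (inl j) l z *
            christoffel (b₁.prod b₂) G l (inl i) (inl k) z)) =
      -((p₂ * p - p₁ ^ 2) / p ^ 2) *
          (∑ i, ξ (b₁ i) * conformalTensor ε (fun i => ξ (b₁ i)) i j k
            - ξ (b₁ j) * ∑ i, conformalTensor ε (fun i => ξ (b₁ i)) i i k)
        + (p₁ / p) ^ 2 * (∑ l, (∑ i, conformalTensor ε (fun i => ξ (b₁ i)) i i l)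
              * conformalTensor ε (fun i => ξ (b₁ i)) l j k
            - ∑ i, ∑ l, conformalTensor ε (fun i => ξ (b₁ i)) i j l
              * conformalTensor ε (fun i => ξ (b₁ i)) l i k) := by
    simp only [hp, hp₁, hp₂, Fintype.sum_sum_type,
      hG.partialDeriv_christoffel_inl_inl_inl b₁ b₂ hz, hG.christoffel_inl_inl_inl b₁ b₂ hz,
      hG.christoffel_inr_inl_inl b₁ b₂ hz, mul_zero, Finset.sum_const_zero, add_zero,
      Finset.sum_add_distrib, Finset.sum_sub_distrib, mul_sub, Finset.mul_sum, Finset.sum_mul]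
    rw [Finset.sum_comm (f := fun l i => (deriv φ (ξ z.1) / φ (ξ z.1)) ^ 2 *
      (conformalTensor ε (fun i => ξ (b₁ i)) i i l * conformalTensor ε (fun i => ξ (b₁ i)) l j k))]
    congr 3 <;>
    · funext i
      exact Finset.sum_congr rfl fun _ _ => by ring
  have hF : ∑ a, (partialDeriv (b₁.prod b₂) (inr a)
        (christoffel (b₁.prod b₂) G (inr a) (inl j) (inl k)) z
      - partialDeriv (b₁.prod b₂) (inl j)
        (christoffel (b₁.prod b₂) G (inr a) (inr a) (inl k)) z
      + ∑ l, (christoffel (b₁.prod b₂) G (inr a) (inr a) l z *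
            christoffel (b₁.prod b₂) G l (inl j) (inl k) z
          - christoffel (b₁.prod b₂) G (inr a) (inl j) l z *
            christoffel (b₁.prod b₂) G l (inr a) (inl k) z)) =
      m * (-((q₂ * q - q₁ ^ 2) / q ^ 2) * (ξ (b₁ j) * ξ (b₁ k))
        - (p₁ / p) * (q₁ / q) * ∑ l, ξ (b₁ l) * conformalTensor ε (fun i => ξ (b₁ i)) l j k
        - (q₁ / q) ^ 2 * (ξ (b₁ j) * ξ (b₁ k))) := by
    simp only [Fintype.sum_sum_type,
      hG.partialDeriv_christoffel_inr_inl_inl b₁ b₂ hz,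
      hG.partialDeriv_christoffel_inr_inr_inl b₁ b₂ hz, hG.christoffel_inl_inl_inl b₁ b₂ hz,
      hG.christoffel_inr_inl_inl b₁ b₂ hz, hG.christoffel_inr_inr_inl b₁ b₂ hz,
      hG.christoffel_inl_inr_inl b₁ b₂ hz, hG.christoffel_inr_inl_inr b₁ b₂ hz,
      mul_zero, zero_mul, sub_zero, zero_sub, if_true, ite_mul, mul_ite, Finset.sum_neg_distrib,
      Finset.sum_ite_eq, Finset.mem_univ, Finset.sum_const, nsmul_eq_mul,
      Finset.card_univ, ← hp, ← hp₁, ← hq, ← hq₁, ← hq₂, ← hm]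
    rw [Finset.mul_sum]
    have : ∀ l, ξ (b₁ l) * (q₁ / q) * (-(p₁ / p) * conformalTensor ε (fun i => ξ (b₁ i)) l j k)
      = -(p₁ / p * (q₁ / q) * (ξ (b₁ l) * conformalTensor ε (fun i => ξ (b₁ i)) l j k)) :=
      fun l => by ring
    simp only [this, Finset.sum_neg_distrib]
    ring
  rw [ricciCoord, Fintype.sum_sum_type, hB, hF]
  simp only [e2, mul_assoc, ← Finset.mul_sum]
  simp only [← mul_assoc, e1, e3, ← hN, ← hn]
  split_ifs with h <;> field_simp <;> ring

/-- See `ricciCoord_inl_inl` for the notation. -/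
theorem ricciCoord_inr_inr (hG : IsWarpedCoord ξ ε φ f B U G) (hz : z.2 ∈ U) (a c : κ)
    {p p₁ q q₁ q₂ n m N : ℝ} (hp : p = φ (ξ z.1)) (hp₁ : p₁ = deriv φ (ξ z.1))
    (hq : q = f (ξ z.1)) (hq₁ : q₁ = deriv f (ξ z.1))
    (hq₂ : q₂ = deriv (deriv f) (ξ z.1)) (hn : n = Fintype.card ι) (hm : m = Fintype.card κ)
    (hN : N = ∑ i, ε i * ξ (b₁ i) ^ 2) :
    ricciCoord (b₁.prod b₂) G (inr a) (inr c) z = ricciCoord b₂ B a c z.2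
      - N * ((m - 1) * p ^ 2 * q₁ ^ 2 + p ^ 2 * q * q₂ - (n - 2) * p * p₁ * q * q₁) * B z.2 a c := by
  have hp0 : p ≠ 0 := hp ▸ hG.conf_ne _
  have hq0 : q ≠ 0 := hq ▸ hG.warp_ne _
  have e2 := sum_conformalTensor_self hG.sign_mul_self (fun i => ξ (b₁ i))
  have hN' : ∀ r : ℝ, ∑ i, r * (ε i * ξ (b₁ i) * ξ (b₁ i)) = r * N := fun r => by
    rw [hN, ← Finset.mul_sum]
    simp only [mul_assoc, pow_two]
  have hB : ∑ i, (partialDeriv (b₁.prod b₂) (inl i)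
        (christoffel (b₁.prod b₂) G (inl i) (inr a) (inr c)) z
      - partialDeriv (b₁.prod b₂) (inr a)
        (christoffel (b₁.prod b₂) G (inl i) (inl i) (inr c)) z
      + ∑ l, (christoffel (b₁.prod b₂) G (inl i) (inl i) l z *
            christoffel (b₁.prod b₂) G l (inr a) (inr c) z
          - christoffel (b₁.prod b₂) G (inl i) (inr a) l z *
            christoffel (b₁.prod b₂) G l (inl i) (inr c) z)) =
      (-(2 * p * p₁ * q * q₁ + p ^ 2 * q₁ ^ 2 + p ^ 2 * q * q₂) + n * p * p₁ * q * q₁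
        + p ^ 2 * q₁ ^ 2) * N * B z.2 a c := by
    simp only [Fintype.sum_sum_type,
      hG.partialDeriv_christoffel_inl_inr_inr b₁ b₂ hz,
      hG.partialDeriv_christoffel_inl_inl_inr b₁ b₂ hz, hG.christoffel_inl_inl_inl b₁ b₂ hz,
      hG.christoffel_inl_inr_inr b₁ b₂ hz, hG.christoffel_inl_inr_inl b₁ b₂ hz,
      hG.christoffel_inl_inl_inr b₁ b₂ hz, hG.christoffel_inr_inl_inr b₁ b₂ hz,
      mul_zero, zero_mul, sub_zero, mul_ite, Finset.sum_add_distrib,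
      Finset.sum_sub_distrib,
      Finset.sum_ite_eq, Finset.mem_univ, if_true, Finset.sum_const_zero,
      ← hp, ← hp₁, ← hq, ← hq₁, ← hq₂]
    rw [Finset.sum_comm]
    simp only [← Finset.sum_mul, ← Finset.mul_sum, e2, ← hn]
    have h1 : ∀ l, -(p₁ / p) * (n * ξ (b₁ l)) * (-(p ^ 2 * q * q₁) * (ε l * ξ (b₁ l) * B z.2 a c))
      = (n * p * p₁ * q * q₁ * B z.2 a c) * (ε l * ξ (b₁ l) * ξ (b₁ l)) := fun l => by
      field_simp
    have h2 : ∀ l, -(p ^ 2 * q * q₁) * (ε l * ξ (b₁ l) * B z.2 a c) * (ξ (b₁ l) * (q₁ / q))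
      = -(p ^ 2 * q₁ ^ 2 * B z.2 a c) * (ε l * ξ (b₁ l) * ξ (b₁ l)) := fun l => by
      field_simp
    have h3 := hN' 1
    simp only [one_mul] at h3
    simp only [h1, h2, hN', h3]
    ring
  have hF : ∑ d, (partialDeriv (b₁.prod b₂) (inr d)
        (christoffel (b₁.prod b₂) G (inr d) (inr a) (inr c)) z
      - partialDeriv (b₁.prod b₂) (inr a)
        (christoffel (b₁.prod b₂) G (inr d) (inr d) (inr c)) z
      + ∑ l, (christoffel (b₁.prod b₂) G (inr d) (inr d) l z *
            christoffel (b₁.prod b₂) G l (inr a) (inr c) z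
          - christoffel (b₁.prod b₂) G (inr d) (inr a) l z *
            christoffel (b₁.prod b₂) G l (inr d) (inr c) z)) =
      ricciCoord b₂ B a c z.2 - (m - 1) * p ^ 2 * q₁ ^ 2 * N * B z.2 a c := by
    simp only [Fintype.sum_sum_type,
      hG.partialDeriv_christoffel_inr_inr_inr b₁ b₂ hz,
      hG.christoffel_inl_inr_inr b₁ b₂ hz, hG.christoffel_inr_inr_inl b₁ b₂ hz,
      hG.christoffel_inr_inr_inr b₁ b₂ hz, if_true, ite_mul, zero_mul,
      Finset.sum_sub_distrib, Finset.sum_add_distrib, ricciCoord,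
      ← hp, ← hq, ← hq₁]
    have h1 : ∀ (l : ι) (d : κ), ξ (b₁ l) * (q₁ / q) * (-(p ^ 2 * q * q₁) * (ε l * ξ (b₁ l) * B z.2 d c))
      = -(p ^ 2 * q₁ ^ 2 * B z.2 d c) * (ε l * ξ (b₁ l) * ξ (b₁ l)) := fun l d => by
      field_simp
    rw [Finset.sum_comm (f := fun (d : κ) (l : ι) => if a = d then _ else _)]
    simp only [h1, hN', Finset.sum_ite_eq, Finset.mem_univ, if_true, Finset.sum_const,
      nsmul_eq_mul, Finset.card_univ, ← hm]
    ring
  rw [ricciCoord, Fintype.sum_sum_type, hB, hF]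
  ring

/-- See `ricciCoord_inl_inl` for the notation. -/
theorem scalarCoord_eq (hG : IsWarpedCoord ξ ε φ f B U G) (hz : z.2 ∈ U)
    {p p₁ p₂ q q₁ q₂ n m N : ℝ} (hp : p = φ (ξ z.1)) (hp₁ : p₁ = deriv φ (ξ z.1))
    (hp₂ : p₂ = deriv (deriv φ) (ξ z.1)) (hq : q = f (ξ z.1)) (hq₁ : q₁ = deriv f (ξ z.1))
    (hq₂ : q₂ = deriv (deriv f) (ξ z.1)) (hn : n = Fintype.card ι) (hm : m = Fintype.card κ)
    (hN : N = ∑ i, ε i * ξ (b₁ i) ^ 2) :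
    scalarCoord (b₁.prod b₂) G z =
      N * ((n - 1) * (2 * p * p₂ - n * p₁ ^ 2) - 2 * (m / q) * (p ^ 2 * q₂ - (n - 2) * p * p₁ * q₁)
        - m * (m - 1) / q ^ 2 * p ^ 2 * q₁ ^ 2) + scalarCoord b₂ B z.2 / q ^ 2 := by
  have hp0 : p ≠ 0 := hp ▸ hG.conf_ne _
  have hq0 : q ≠ 0 := hq ▸ hG.warp_ne _
  have hB : ∑ j, ε j * p ^ 2 * ricciCoord (b₁.prod b₂) G (inl j) (inl j) z =
      p ^ 2 * (N * ((n - 2) * p₂ / p - m * q₂ / q - 2 * m * (p₁ / p) * (q₁ / q))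
        + n * N * (p₂ / p - (n - 1) * (p₁ / p) ^ 2 + m * (p₁ / p) * (q₁ / q))) := by
    simp only [hG.ricciCoord_inl_inl b₁ b₂ hz _ _ hp hp₁ hp₂ hq hq₁ hq₂ hn hm hN, if_true]
    have : ∀ (j : ι) (x y : ℝ), ε j * p ^ 2 * (x * (ξ (b₁ j) * ξ (b₁ j)) + ε j * N * y)
        = p ^ 2 * x * (ε j * ξ (b₁ j) ^ 2) + p ^ 2 * N * y := fun j x y => by
      linear_combination p ^ 2 * N * y * hG.sign_mul_self j
    simp only [this, Finset.sum_add_distrib, ← Finset.mul_sum, ← hN, Finset.sum_const,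
      nsmul_eq_mul, Finset.card_univ, ← hn]
    ring
  have hF : ∑ a, ∑ c, (q ^ 2)⁻¹ * (B z.2)⁻¹ a c * ricciCoord (b₁.prod b₂) G (inr a) (inr c) z =
      scalarCoord b₂ B z.2 / q ^ 2
        - m * N * ((m - 1) * p ^ 2 * q₁ ^ 2 + p ^ 2 * q * q₂ - (n - 2) * p * p₁ * q * q₁) / q ^ 2 := by
    simp only [hG.ricciCoord_inr_inr b₁ b₂ hz _ _ hp hp₁ hq hq₁ hq₂ hn hm hN]
    have h1 : ∀ a, ∑ c, (B z.2)⁻¹ a c * B z.2 a c = 1 := fun a => by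
      simpa using hG.sum_inv_mul hz a a
    have : ∀ (a c : κ) (x y : ℝ), (q ^ 2)⁻¹ * (B z.2)⁻¹ a c * (x - y * B z.2 a c)
        = (q ^ 2)⁻¹ * ((B z.2)⁻¹ a c * x) - (q ^ 2)⁻¹ * y * ((B z.2)⁻¹ a c * B z.2 a c) :=
      fun a c x y => by ring
    simp only [this, Finset.sum_sub_distrib, ← Finset.mul_sum, h1, Finset.sum_const,
      nsmul_eq_mul, Finset.card_univ, ← hm, scalarCoord]
    ring
  simp only [scalarCoord, Fintype.sum_sum_type, hG.inv_eq hz, Matrix.fromBlocks_apply₁₁,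
    Matrix.fromBlocks_apply₁₂, Matrix.fromBlocks_apply₂₁, Matrix.fromBlocks_apply₂₂,
    Matrix.zero_apply, zero_mul, Finset.sum_const_zero, zero_add, add_zero, Matrix.diagonal_apply,
    ite_mul, Finset.sum_ite_eq, Finset.mem_univ, if_true, Matrix.smul_apply, smul_eq_mul, ← hp,
    ← hq]
  rw [hB, hF, scalarCoord]
  field_simp
  ring

/-! ### The Hessian of a function of `ξ` -/

variable {h : ℝ → ℝ}

theorem hessCoord_inl_inl (hG : IsWarpedCoord ξ ε φ f B U G) (hz : z.2 ∈ U)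
    (hh : ContDiff ℝ ∞ h) (i j : ι) :
    hessCoord (b₁.prod b₂) G (fun y => h (ξ y.1)) (inl i) (inl j) z =
      ξ (b₁ i) * ξ (b₁ j) * (deriv (deriv h) (ξ z.1)
          + 2 * (deriv φ (ξ z.1) * deriv h (ξ z.1) / φ (ξ z.1)))
        - if i = j then ε i * (deriv φ (ξ z.1) * deriv h (ξ z.1) / φ (ξ z.1))
            * ∑ k, ε k * ξ (b₁ k) ^ 2 else 0 := by
  have hd := ((((contDiff_infty_iff_deriv.1 hh).2).differentiable (by simp)
    (ξ z.1)).hasDerivAt).const_mul (ξ (b₁ j))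
  have e : ∀ k, -(deriv φ (ξ z.1) / φ (ξ z.1)) * conformalTensor ε (fun i => ξ (b₁ i)) k i j
      * (ξ (b₁ k) * deriv h (ξ z.1)) = -(deriv φ (ξ z.1) * deriv h (ξ z.1) / φ (ξ z.1))
      * (ξ (b₁ k) * conformalTensor ε (fun i => ξ (b₁ i)) k i j) := fun k => by ring
  rw [hessCoord, partialDeriv_inl_profile b₁ b₂ ξ i
    (.of_forall fun y => partialDeriv_inl_potential b₁ b₂ ξ hh j y) hd]
  simp only [Fintype.sum_sum_type, partialDeriv_inl_potential b₁ b₂ ξ hh,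
    partialDeriv_inr_potential b₁ b₂ ξ hh, mul_zero, Finset.sum_const_zero, add_zero,
    hG.christoffel_inl_inl_inl b₁ b₂ hz, e, ← Finset.mul_sum, sum_mul_conformalTensor]
  split_ifs <;> ring

theorem hessCoord_inl_inr (hG : IsWarpedCoord ξ ε φ f B U G) (hz : z.2 ∈ U)
    (hh : ContDiff ℝ ∞ h) (i : ι) (a : κ) :
    hessCoord (b₁.prod b₂) G (fun y => h (ξ y.1)) (inl i) (inr a) z = 0 := by
  rw [hessCoord, partialDeriv_zero _ _
    (.of_forall fun y => partialDeriv_inr_potential b₁ b₂ ξ hh a y)]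
  simp [partialDeriv_inr_potential b₁ b₂ ξ hh, hG.christoffel_inl_inl_inr b₁ b₂ hz]

theorem hessCoord_inr_inl (hG : IsWarpedCoord ξ ε φ f B U G) (hz : z.2 ∈ U)
    (hh : ContDiff ℝ ∞ h) (i : ι) (a : κ) :
    hessCoord (b₁.prod b₂) G (fun y => h (ξ y.1)) (inr a) (inl i) z = 0 := by
  have hd := ((((contDiff_infty_iff_deriv.1 hh).2).differentiable (by simp)
    (ξ z.1)).hasDerivAt).const_mul (ξ (b₁ i))
  rw [hessCoord, partialDeriv_inr_profile b₁ b₂ ξ a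
    (.of_forall fun y => partialDeriv_inl_potential b₁ b₂ ξ hh i y) hd]
  simp [partialDeriv_inr_potential b₁ b₂ ξ hh, hG.christoffel_inl_inr_inl b₁ b₂ hz]

theorem hessCoord_inr_inr (hG : IsWarpedCoord ξ ε φ f B U G) (hz : z.2 ∈ U)
    (hh : ContDiff ℝ ∞ h) (a c : κ) :
    hessCoord (b₁.prod b₂) G (fun y => h (ξ y.1)) (inr a) (inr c) z =
      φ (ξ z.1) ^ 2 * f (ξ z.1) * deriv f (ξ z.1) * deriv h (ξ z.1)
        * (∑ k, ε k * ξ (b₁ k) ^ 2) * B z.2 a c := by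
  rw [hessCoord, partialDeriv_zero _ _
    (.of_forall fun y => partialDeriv_inr_potential b₁ b₂ ξ hh c y)]
  simp only [Fintype.sum_sum_type, partialDeriv_inr_potential b₁ b₂ ξ hh, mul_zero,
    partialDeriv_inl_potential b₁ b₂ ξ hh, hG.christoffel_inl_inr_inr b₁ b₂ hz,
    Finset.sum_const_zero, add_zero, zero_sub, Finset.mul_sum, Finset.sum_mul,
    ← Finset.sum_neg_distrib]
  exact Finset.sum_congr rfl fun k _ => by ring

end IsWarpedCoord

end WarpedCoordinates

/-! ### The warped product metric in the product charts -/

section WarpedManifold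

variable {n m : ℕ} {F : Type*} [TopologicalSpace F] [ChartedSpace (EuclideanSpace ℝ (Fin m)) F]
  {gF : TensorField (𝓡 m) F}

/-- The linear form `ξ = ∑ α_k x_k` as a continuous linear map. -/
def xiCLM (α : Fin n → ℝ) : EuclideanSpace ℝ (Fin n) →L[ℝ] ℝ :=
  ∑ k, α k • EuclideanSpace.proj k

@[simp]
theorem xiCLM_apply (α : Fin n → ℝ) (x : EuclideanSpace ℝ (Fin n)) : xiCLM α x = xi α x := by
  simp [xiCLM, xi]

theorem xi_stdBasis (α : Fin n → ℝ) (i : Fin n) : xi α (stdBasis n i) = α i := by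
  simp [xi]

theorem conformalMetric_apply (ε : Fin n → ℝ) (ψ : EuclideanSpace ℝ (Fin n) → ℝ)
    (x v w : EuclideanSpace ℝ (Fin n)) :
    (conformalMetric ε ψ x : LinearMap.BilinForm ℝ (EuclideanSpace ℝ (Fin n))) v w
      = 1 / ψ x ^ 2 * ∑ i, ε i * (v i * w i) := rfl

theorem metricCoord_symm (hgF : IsPseudoRiemannianMetric (stdBasis m) gF) (y : F)
    (w : EuclideanSpace ℝ (Fin m)) (a c : Fin m) :
    metricCoord (stdBasis m) gF y w a c = metricCoord (stdBasis m) gF y w c a :=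
  (hgF.symm _).eq _ _

theorem warpedMetric_conformalMetric_apply (ε : Fin n → ℝ) (ψ η : EuclideanSpace ℝ (Fin n) → ℝ)
    (p : EuclideanSpace ℝ (Fin n) × F) (v w : TangentSpace ((𝓡 n).prod (𝓡 m)) p) :
    warpedMetric (conformalMetric ε ψ) η gF p v w
      = conformalMetric ε ψ p.1 v.1 w.1 + η p.1 ^ 2 * gF p.2 v.2 w.2 := by
  rw [warpedMetric, mfderiv_fst, mfderiv_snd]
  rfl

theorem isSymm_warpedMetric (hgF : IsPseudoRiemannianMetric (stdBasis m) gF) (ε : Fin n → ℝ)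
    (ψ η : EuclideanSpace ℝ (Fin n) → ℝ) (p : EuclideanSpace ℝ (Fin n) × F) :
    (warpedMetric (conformalMetric ε ψ) η gF p).IsSymm := by
  constructor
  intro v w
  have h : conformalMetric ε ψ p.1 v.1 w.1 = conformalMetric ε ψ p.1 w.1 v.1 := by
    rw [conformalMetric_apply, conformalMetric_apply]
    exact congrArg _ (Finset.sum_congr rfl fun i _ => by rw [mul_comm (v.1.ofLp i)])
  change warpedMetric _ _ gF p v w = warpedMetric _ _ gF p w v
  rw [warpedMetric_conformalMetric_apply, warpedMetric_conformalMetric_apply, h]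
  have h' : gF p.2 v.2 w.2 = gF p.2 w.2 v.2 := (hgF.symm p.2).eq v.2 w.2
  rw [h']

theorem nondegenerate_warpedMetric (hgF : IsPseudoRiemannianMetric (stdBasis m) gF)
    {ε : Fin n → ℝ} (hε : ∀ i, ε i ≠ 0) {ψ η : EuclideanSpace ℝ (Fin n) → ℝ}
    (hψ : ∀ x, ψ x ≠ 0) (hη : ∀ x, η x ≠ 0) (p : EuclideanSpace ℝ (Fin n) × F) :
    (warpedMetric (conformalMetric ε ψ) η gF p).Nondegenerate := by
  rw [LinearMap.BilinForm.Nondegenerate,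
    (isSymm_warpedMetric hgF ε ψ η p).isRefl.nondegenerate_iff_separatingLeft]
  intro v hv
  have h1 : v.1 = (0 : EuclideanSpace ℝ (Fin n)) := by
    ext i
    have h := (warpedMetric_conformalMetric_apply ε ψ η p v
      ((EuclideanSpace.single i 1 : EuclideanSpace ℝ (Fin n)),
        (0 : EuclideanSpace ℝ (Fin m)))).symm.trans (hv _)
    rw [conformalMetric_apply] at h
    have h0 : gF p.2 v.2 (0 : EuclideanSpace ℝ (Fin m)) = 0 := map_zero (gF p.2 v.2)
    rw [h0] at h
    simpa [hψ, hε] using h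
  have h2 : v.2 = (0 : EuclideanSpace ℝ (Fin m)) := by
    refine (hgF.nondegenerate p.2).1 v.2 fun w => ?_
    have h := (warpedMetric_conformalMetric_apply ε ψ η p v
      ((0 : EuclideanSpace ℝ (Fin n)), w)).symm.trans (hv _)
    rw [conformalMetric_apply] at h
    simpa [hη] using h
  exact Prod.ext h1 h2

theorem extChartAt_prod_target (p : EuclideanSpace ℝ (Fin n) × F) :
    (extChartAt ((𝓡 n).prod (𝓡 m)) p).target = Prod.snd ⁻¹' (extChartAt (𝓡 m) p.2).target := by
  rw [extChartAt_prod, extChartAt_model_space_eq_id, PartialEquiv.prod_target]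
  exact Set.univ_prod

theorem contMDiff_potential (α : Fin n → ℝ) {h : ℝ → ℝ} (hh : ContDiff ℝ ∞ h) :
    ContMDiff ((𝓡 n).prod (𝓡 m)) 𝓘(ℝ, ℝ) ∞
      (fun p : EuclideanSpace ℝ (Fin n) × F => h (xi α p.1)) := by
  have h1 : ContDiff ℝ ∞ fun x : EuclideanSpace ℝ (Fin n) => h (xi α x) := by
    simp only [← xiCLM_apply]
    fun_prop
  exact h1.contMDiff.comp contMDiff_fst

variable [IsManifold (𝓡 m) ∞ F]

theorem mdifferentiableAt_extChartAt_symm {y : F} {w : EuclideanSpace ℝ (Fin m)}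
    (hw : w ∈ (extChartAt (𝓡 m) y).target) :
    MDifferentiableAt 𝓘(ℝ, EuclideanSpace ℝ (Fin m)) (𝓡 m) (extChartAt (𝓡 m) y).symm w := by
  have : IsManifold (𝓡 m) 1 F := .of_le (n := ∞) (by simp)
  have h := mdifferentiableWithinAt_extChartAt_symm (I := 𝓡 m) hw
  rwa [ModelWithCorners.range_eq_univ, mdifferentiableWithinAt_univ] at h

/-- The coordinate vectors are the image of a basis under the invertible differential of the inverse
chart, so `metricCoord` is the Gram matrix of a nondegenerate form in a basis. -/
theorem isUnit_metricCoord (hgF : IsPseudoRiemannianMetric (stdBasis m) gF) {y : F}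
    {w : EuclideanSpace ℝ (Fin m)} (hw : w ∈ (extChartAt (𝓡 m) y).target) :
    IsUnit (metricCoord (stdBasis m) gF y w) := by
  have : IsManifold (𝓡 m) 1 F := .of_le (n := ∞) (by simp)
  have h := isInvertible_mfderivWithin_extChartAt_symm (I := 𝓡 m) hw
  rw [ModelWithCorners.range_eq_univ, mfderivWithin_univ] at h
  obtain ⟨e, he⟩ := h
  let b' : Module.Basis (Fin m) ℝ (TangentSpace (𝓡 m) ((extChartAt (𝓡 m) y).symm w)) :=
    (stdBasis m).map e.toLinearEquiv
  have hb' : ∀ i, b' i = coordVector (𝓡 m) (stdBasis m) y i w := fun i => by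
    rw [coordVector, ← he]
    exact Module.Basis.map_apply _ _ _
  have hM : metricCoord (stdBasis m) gF y w
      = LinearMap.BilinForm.toMatrix b' (gF ((extChartAt (𝓡 m) y).symm w)) := by
    refine Matrix.ext fun i j => ?_
    rw [LinearMap.BilinForm.toMatrix_apply, hb', hb']
    rfl
  rw [hM, Matrix.isUnit_iff_isUnit_det, isUnit_iff_ne_zero]
  exact (LinearMap.BilinForm.nondegenerate_iff_det_ne_zero b').1 (hgF.nondegenerate _)

variable (p : EuclideanSpace ℝ (Fin n) × F)
  {z : EuclideanSpace ℝ (Fin n) × EuclideanSpace ℝ (Fin m)}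

/-- The chart of `ℝⁿ` is the identity, so only the second component is differentiated. -/
theorem mfderiv_prod_extChartAt_symm (hz : z.2 ∈ (extChartAt (𝓡 m) p.2).target)
    (v : EuclideanSpace ℝ (Fin n) × EuclideanSpace ℝ (Fin m)) :
    mfderiv 𝓘(ℝ, EuclideanSpace ℝ (Fin n) × EuclideanSpace ℝ (Fin m)) ((𝓡 n).prod (𝓡 m))
      (extChartAt ((𝓡 n).prod (𝓡 m)) p).symm z v
      = (v.1, mfderiv 𝓘(ℝ, EuclideanSpace ℝ (Fin m)) (𝓡 m) (extChartAt (𝓡 m) p.2).symm z.2 v.2) := by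
  have h1 : MDifferentiableAt 𝓘(ℝ, EuclideanSpace ℝ (Fin n) × EuclideanSpace ℝ (Fin m)) (𝓡 n)
      (Prod.fst : EuclideanSpace ℝ (Fin n) × EuclideanSpace ℝ (Fin m) → _) z :=
    differentiableAt_fst.mdifferentiableAt
  have h2 : MDifferentiableAt 𝓘(ℝ, EuclideanSpace ℝ (Fin n) × EuclideanSpace ℝ (Fin m))
      𝓘(ℝ, EuclideanSpace ℝ (Fin m))
      (Prod.snd : EuclideanSpace ℝ (Fin n) × EuclideanSpace ℝ (Fin m) → _) z :=
    differentiableAt_snd.mdifferentiableAt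
  have h3 := (mdifferentiableAt_extChartAt_symm hz)
  have h4 := h3.comp z h2
  have h5 : ((extChartAt ((𝓡 n).prod (𝓡 m)) p).symm :
      EuclideanSpace ℝ (Fin n) × EuclideanSpace ℝ (Fin m) → EuclideanSpace ℝ (Fin n) × F)
      = fun z => (z.1, ((extChartAt (𝓡 m) p.2).symm ∘ Prod.snd) z) := rfl
  rw [h5, h1.mfderiv_prod h4, mfderiv_comp z h3 h2, mfderiv_eq_fderiv, mfderiv_eq_fderiv,
    fderiv_fst, fderiv_snd]
  rfl

theorem metricCoord_warpedMetric (ε α : Fin n → ℝ) (φ f : ℝ → ℝ)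
    (hz : z.2 ∈ (extChartAt (𝓡 m) p.2).target) :
    metricCoord ((stdBasis n).prod (stdBasis m))
      (warpedMetric (conformalMetric ε (fun x => φ (xi α x))) (fun x => f (xi α x)) gF) p z
      = Matrix.fromBlocks (Matrix.diagonal fun i => ε i / φ (xiCLM α z.1) ^ 2) 0 0
        (f (xiCLM α z.1) ^ 2 • metricCoord (stdBasis m) gF p.2 z.2) := by
  have hb : ∀ s, coordVector ((𝓡 n).prod (𝓡 m)) ((stdBasis n).prod (stdBasis m)) p s z
      = ((((stdBasis n).prod (stdBasis m)) s).1, mfderiv 𝓘(ℝ, EuclideanSpace ℝ (Fin m)) (𝓡 m)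
        (extChartAt (𝓡 m) p.2).symm z.2 (((stdBasis n).prod (stdBasis m)) s).2) := fun s =>
    mfderiv_prod_extChartAt_symm p hz _
  -- The tangent spaces are identified with the model space, and `L` with a linear map on it.
  obtain ⟨L, Q, hL, hQ⟩ : ∃ (L : EuclideanSpace ℝ (Fin m) →L[ℝ] EuclideanSpace ℝ (Fin m))
      (Q : LinearMap.BilinForm ℝ (EuclideanSpace ℝ (Fin m))),
      (∀ s t, metricCoord ((stdBasis n).prod (stdBasis m))
        (warpedMetric (conformalMetric ε (fun x => φ (xi α x))) (fun x => f (xi α x)) gF) p z s t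
        = 1 / φ (xi α z.1) ^ 2 * ∑ i, ε i * ((((stdBasis n).prod (stdBasis m)) s).1 i
            * (((stdBasis n).prod (stdBasis m)) t).1 i)
          + f (xi α z.1) ^ 2 * Q (L (((stdBasis n).prod (stdBasis m)) s).2)
            (L (((stdBasis n).prod (stdBasis m)) t).2)) ∧
      ∀ a c, metricCoord (stdBasis m) gF p.2 z.2 a c = Q (L (stdBasis m a)) (L (stdBasis m c)) := by
    refine ⟨mfderiv 𝓘(ℝ, EuclideanSpace ℝ (Fin m)) (𝓡 m) (extChartAt (𝓡 m) p.2).symm z.2,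
      gF ((extChartAt (𝓡 m) p.2).symm z.2), fun s t => ?_, fun _ _ => rfl⟩
    rw [metricCoord, Matrix.of_apply, hb, hb, warpedMetric, mfderiv_fst, mfderiv_snd]
    rfl
  ext s t
  rw [hL]
  rcases s with i | a <;> rcases t with j | c
  · by_cases h : i = j
    · subst h
      simp [div_eq_inv_mul]
    · simp [h, Ne.symm h]
  · simp
  · simp
  · simp only [Matrix.fromBlocks_apply₂₂, Matrix.smul_apply, hQ]
    simp

theorem isWarpedCoord_metricCoord (hgF : IsPseudoRiemannianMetric (stdBasis m) gF)
    {ε : Fin n → ℝ} (hε : ∀ i, ε i = 1 ∨ ε i = -1) (α : Fin n → ℝ) {φ f : ℝ → ℝ}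
    (hf : ContDiff ℝ ∞ f) (hφ : ContDiff ℝ ∞ φ) (hf0 : ∀ t, f t ≠ 0) (hφ0 : ∀ t, φ t ≠ 0) :
    IsWarpedCoord (xiCLM α) ε φ f (metricCoord (stdBasis m) gF p.2) (extChartAt (𝓡 m) p.2).target
      (metricCoord ((stdBasis n).prod (stdBasis m))
        (warpedMetric (conformalMetric ε (fun x => φ (xi α x))) (fun x => f (xi α x)) gF) p) where
  sign := hε
  smooth_conf := hφ
  smooth_warp := hf
  conf_ne := hφ0
  warp_ne := hf0
  isOpen := isOpen_extChartAt_target _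
  symm := metricCoord_symm hgF _
  isUnit _ hw := isUnit_metricCoord hgF hw
  diff w hw a c := ((hgF.smooth p.2 a c).contDiffAt
    ((isOpen_extChartAt_target _).mem_nhds hw)).differentiableAt (by simp)
  eq _ hz := metricCoord_warpedMetric p ε α φ f hz

theorem isPseudoRiemannianMetric_warpedMetric (hgF : IsPseudoRiemannianMetric (stdBasis m) gF)
    {ε : Fin n → ℝ} (hε : ∀ i, ε i = 1 ∨ ε i = -1) (α : Fin n → ℝ) {φ f : ℝ → ℝ}
    (hf : ContDiff ℝ ∞ f) (hφ : ContDiff ℝ ∞ φ) (hf0 : ∀ t, f t ≠ 0) (hφ0 : ∀ t, φ t ≠ 0) :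
    IsPseudoRiemannianMetric ((stdBasis n).prod (stdBasis m))
      (warpedMetric (conformalMetric ε (fun x => φ (xi α x))) (fun x => f (xi α x)) gF) where
  symm := isSymm_warpedMetric hgF _ _ _
  nondegenerate := nondegenerate_warpedMetric hgF
    (fun i => by rcases hε i with h | h <;> simp [h]) (fun _ => hφ0 _) (fun _ => hf0 _)
  smooth p s t := by
    rw [extChartAt_prod_target]
    refine ContDiffOn.congr ?_ fun z hz => by
      rw [metricCoord_warpedMetric p ε α φ f hz]
    have h1 : ContDiff ℝ ∞ fun z : EuclideanSpace ℝ (Fin n) × EuclideanSpace ℝ (Fin m) =>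
        f (xiCLM α z.1) := by fun_prop
    have h2 : ContDiff ℝ ∞ fun z : EuclideanSpace ℝ (Fin n) × EuclideanSpace ℝ (Fin m) =>
        φ (xiCLM α z.1) := by fun_prop
    rcases s with i | a <;> rcases t with j | c
    · by_cases h : i = j
      · subst h
        simp only [Matrix.fromBlocks_apply₁₁, Matrix.diagonal_apply_eq]
        exact (contDiff_const.div (h2.pow 2) fun z => pow_ne_zero 2 (hφ0 _)).contDiffOn
      · simpa [h] using contDiffOn_const
    · simpa using contDiffOn_const
    · simpa using contDiffOn_const
    · simp only [Matrix.fromBlocks_apply₂₂, Matrix.smul_apply, smul_eq_mul]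
      exact (h1.pow 2).contDiffOn.mul
        ((hgF.smooth p.2 a c).comp contDiff_snd.contDiffOn fun _ hz => hz)

/-! ### The soliton equation -/

/-- The block of the soliton equation along `ℝⁿ`: two tensors, `α ⊗ α` and `diag(ε)`, are
compared, and in dimension at least two the former is not a multiple of the latter. -/
theorem forall_smul_diagonal_eq_iff {ι : Type*} [DecidableEq ι] [Nontrivial ι] {ε α : ι → ℝ}
    (hε : ∀ i, ε i * ε i = 1) (hα : α ≠ 0) {p T D c N : ℝ} (hp : p ≠ 0) :
    (∀ i j, T * Matrix.diagonal (fun i => ε i / p ^ 2) i j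
      = α i * α j * D - if i = j then ε i * c * N else 0) ↔ D = 0 ∧ T = -(p ^ 2 * c * N) := by
  have of_diag : ∀ i, T * (ε i / p ^ 2) = 0 - ε i * c * N → T = -(p ^ 2 * c * N) := fun i h => by
    field_simp at h
    linear_combination ε i * h - (T + p ^ 2 * c * N) * hε i
  constructor
  · intro H
    obtain ⟨k, hk⟩ := Function.ne_iff.1 hα
    rw [Pi.zero_apply] at hk
    have hdiag : ∀ i, T * (ε i / p ^ 2) = α i * α i * D - ε i * c * N := fun i => by
      simpa using H i i
    obtain ⟨j, hj⟩ := exists_ne k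
    have hD : D = 0 := by
      by_cases hαj : α j = 0
      · have hT : T = -(p ^ 2 * c * N) := of_diag j (by simpa [hαj] using hdiag j)
        have h1 := hdiag k
        rw [hT] at h1
        have h2 : α k * α k * D = 0 := by
          have : -(p ^ 2 * c * N) * (ε k / p ^ 2) = -(ε k * c * N) := by field_simp
          linear_combination this - h1
        simpa [hk] using h2
      · have h1 := H k j
        simpa [hj.symm, hk, hαj] using h1.symm
    exact ⟨hD, of_diag k (by simpa [hD] using hdiag k)⟩
  · rintro ⟨rfl, rfl⟩ i j
    by_cases h : i = j
    · subst h
      simp only [Matrix.diagonal_apply_eq, if_true]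
      field_simp
      ring
    · simp [h]

theorem exists_metricCoord_ne_zero (hm : 1 ≤ m) (hgF : IsPseudoRiemannianMetric (stdBasis m) gF)
    {y : F} {w : EuclideanSpace ℝ (Fin m)} (hw : w ∈ (extChartAt (𝓡 m) y).target) :
    ∃ a c, metricCoord (stdBasis m) gF y w a c ≠ 0 := by
  have : Nonempty (Fin m) := ⟨⟨0, hm⟩⟩
  by_contra! h
  exact (isUnit_metricCoord hgF hw).ne_zero (Matrix.ext h)

/-- The soliton equation as a system of ordinary differential equations, for an arbitrary value `N`
of `∑ ε_k α_k²`: the `α ⊗ α` part and the `diag(ε)` part of the block along `ℝⁿ`, and the block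
along the fibre. Since `F` is nonempty and `α ≠ 0`, the function `ξ` takes every real value on
`ℝⁿ × F`. -/
theorem isGradientYamabeSoliton_iff [Nonempty F] (hn : 2 ≤ n) (hm : 1 ≤ m)
    (hgF : IsPseudoRiemannianMetric (stdBasis m) gF) {lamF : ℝ}
    (hlamF : ∀ y, scalarCurvature (stdBasis m) gF y = lamF)
    {ε : Fin n → ℝ} (hε : ∀ i, ε i = 1 ∨ ε i = -1) {α : Fin n → ℝ} (hα : α ≠ 0)
    {f φ h : ℝ → ℝ} (hf : ContDiff ℝ ∞ f) (hφ : ContDiff ℝ ∞ φ) (hh : ContDiff ℝ ∞ h)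
    (hf0 : ∀ t, f t ≠ 0) (hφ0 : ∀ t, φ t ≠ 0) (ρ : ℝ) {N : ℝ} (hN : ∑ k, ε k * α k ^ 2 = N) :
    IsGradientYamabeSoliton ((stdBasis n).prod (stdBasis m))
        (warpedMetric (conformalMetric ε (fun x => φ (xi α x))) (fun x => f (xi α x)) gF)
        (fun p : EuclideanSpace ℝ (Fin n) × F => h (xi α p.1)) ρ ↔
      ∀ t : ℝ,
        deriv (deriv h) t + 2 * (deriv φ t * deriv h t / φ t) = 0 ∧
        N * (((n : ℝ) - 1) * (2 * φ t * deriv (deriv φ) t - n * deriv φ t ^ 2)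
            - 2 * (m / f t) * (φ t ^ 2 * deriv (deriv f) t
                - ((n : ℝ) - 2) * φ t * deriv φ t * deriv f t)
            - m * ((m : ℝ) - 1) / f t ^ 2 * φ t ^ 2 * deriv f t ^ 2
            + deriv φ t * deriv h t * φ t) = ρ - lamF / f t ^ 2 ∧
        N * (((n : ℝ) - 1) * (2 * φ t * deriv (deriv φ) t - n * deriv φ t ^ 2)
            - 2 * (m / f t) * (φ t ^ 2 * deriv (deriv f) t
                - ((n : ℝ) - 2) * φ t * deriv φ t * deriv f t)
            - m * ((m : ℝ) - 1) / f t ^ 2 * φ t ^ 2 * deriv f t ^ 2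
            - φ t ^ 2 / f t * deriv f t * deriv h t) = ρ - lamF / f t ^ 2 := by
  set g := warpedMetric (conformalMetric ε (fun x => φ (xi α x))) (fun x => f (xi α x)) gF
  have hN' : ∑ k, ε k * xiCLM α (stdBasis n k) ^ 2 = N := by
    simpa only [xiCLM_apply, xi_stdBasis] using hN
  have hmem : ∀ p : EuclideanSpace ℝ (Fin n) × F,
      (extChartAt ((𝓡 n).prod (𝓡 m)) p p).2 ∈ (extChartAt (𝓡 m) p.2).target := fun p =>
    mem_extChartAt_target p.2
  have hW := fun p : EuclideanSpace ℝ (Fin n) × F =>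
    isWarpedCoord_metricCoord p hgF hε α hf hφ hf0 hφ0
  -- The right-hand sides left open below are filled in by the coordinate formulas.
  have hS : ∀ p : EuclideanSpace ℝ (Fin n) × F,
      scalarCurvature ((stdBasis n).prod (stdBasis m)) g p = _ := fun p =>
    (hW p).scalarCoord_eq (stdBasis n) (stdBasis m) (hmem p) rfl rfl rfl rfl rfl rfl
      rfl rfl hN'.symm
  have hlam : ∀ p : EuclideanSpace ℝ (Fin n) × F, scalarCoord (stdBasis m)
      (metricCoord (stdBasis m) gF p.2) (extChartAt ((𝓡 n).prod (𝓡 m)) p p).2 = lamF := fun p =>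
    hlamF p.2
  have hξ : ∀ p : EuclideanSpace ℝ (Fin n) × F,
      xiCLM α (extChartAt ((𝓡 n).prod (𝓡 m)) p p).1 = xi α p.1 := fun p => xiCLM_apply α p.1
  have hM : ∀ p : EuclideanSpace ℝ (Fin n) × F, _ := fun p =>
    metricCoord_warpedMetric (gF := gF) p ε α φ f (hmem p)
  have hu : ∀ p : EuclideanSpace ℝ (Fin n) × F,
      (fun z => h (xi α ((extChartAt ((𝓡 n).prod (𝓡 m)) p).symm z).1))
      = fun z => h (xiCLM α z.1) := fun p => by
    funext z
    rw [xiCLM_apply]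
    rfl
  simp only [hξ, hlam, Fintype.card_fin] at hS hM
  have hbb : ∀ (p : EuclideanSpace ℝ (Fin n) × F) (i j : Fin n),
      hessian ((stdBasis n).prod (stdBasis m)) g (fun p => h (xi α p.1)) p (inl i) (inl j) = _ :=
    fun p i j => (congrArg (fun u => hessCoord _ _ u _ _ _) (hu p)).trans
      ((hW p).hessCoord_inl_inl (stdBasis n) (stdBasis m) (hmem p) hh i j)
  have hbf : ∀ (p : EuclideanSpace ℝ (Fin n) × F) (i : Fin n) (a : Fin m),
      hessian ((stdBasis n).prod (stdBasis m)) g (fun p => h (xi α p.1)) p (inl i) (inr a) = 0 :=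
    fun p i a => (congrArg (fun u => hessCoord _ _ u _ _ _) (hu p)).trans
      ((hW p).hessCoord_inl_inr (stdBasis n) (stdBasis m) (hmem p) hh i a)
  have hfb : ∀ (p : EuclideanSpace ℝ (Fin n) × F) (i : Fin n) (a : Fin m),
      hessian ((stdBasis n).prod (stdBasis m)) g (fun p => h (xi α p.1)) p (inr a) (inl i) = 0 :=
    fun p i a => (congrArg (fun u => hessCoord _ _ u _ _ _) (hu p)).trans
      ((hW p).hessCoord_inr_inl (stdBasis n) (stdBasis m) (hmem p) hh i a)
  have hff : ∀ (p : EuclideanSpace ℝ (Fin n) × F) (a c : Fin m),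
      hessian ((stdBasis n).prod (stdBasis m)) g (fun p => h (xi α p.1)) p (inr a) (inr c) = _ :=
    fun p a c => (congrArg (fun u => hessCoord _ _ u _ _ _) (hu p)).trans
      ((hW p).hessCoord_inr_inr (stdBasis n) (stdBasis m) (hmem p) hh a c)
  simp only [hξ, hN'] at hbb hff
  simp only [xiCLM_apply, xi_stdBasis] at hbb
  have hsq : ∀ i, ε i * ε i = 1 := fun i => by rcases hε i with h | h <;> simp [h]
  have : Nontrivial (Fin n) := Fin.nontrivial_iff_two_le.2 hn
  constructor
  · intro hsol t
    obtain ⟨k, hk⟩ := Function.ne_iff.1 hα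
    rw [Pi.zero_apply] at hk
    obtain ⟨y⟩ := ‹Nonempty F›
    -- A point of `ℝⁿ` where `ξ` takes the value `t`.
    let p : EuclideanSpace ℝ (Fin n) × F := (EuclideanSpace.single k (t / α k), y)
    have ht : xi α p.1 = t := by simp [p, xi, mul_div_cancel₀, hk]
    have heq := hsol.equation p
    rw [hS, hM, ht] at heq
    have hφt := hφ0 t
    have hft := hf0 t
    obtain ⟨a, c, hac⟩ := exists_metricCoord_ne_zero hm hgF (hmem p)
    have hfib := heq (inr a) (inr c)
    rw [hff, ht, Matrix.fromBlocks_apply₂₂, Matrix.smul_apply, smul_eq_mul, ← mul_assoc] at hfib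
    replace hfib := mul_right_cancel₀ hac hfib
    obtain ⟨hD, hT⟩ := (forall_smul_diagonal_eq_iff hsq hα hφt).1 fun i j => by
      have h := heq (inl i) (inl j)
      rwa [hbb, ht] at h
    refine ⟨hD, ?_, ?_⟩
    · have : φ t ^ 2 * (deriv φ t * deriv h t / φ t) * N = deriv φ t * deriv h t * φ t * N := by
        field_simp
      linear_combination hT - this
    · have : φ t ^ 2 * f t * deriv f t * deriv h t * N
          = N * (φ t ^ 2 / f t * deriv f t * deriv h t) * f t ^ 2 := by
        field_simp
      rw [this] at hfib
      linear_combination mul_right_cancel₀ (pow_ne_zero 2 hft) hfib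
  · intro hsys
    refine ⟨isPseudoRiemannianMetric_warpedMetric hgF hε α hf hφ hf0 hφ0,
      contMDiff_potential α hh, fun p s t => ?_⟩
    obtain ⟨hD, hB, hF⟩ := hsys (xi α p.1)
    have hφt := hφ0 (xi α p.1)
    have hft := hf0 (xi α p.1)
    rw [hS, hM]
    rcases s with i | a <;> rcases t with j | c
    · rw [hbb]
      refine (forall_smul_diagonal_eq_iff hsq hα hφt).2 ⟨hD, ?_⟩ i j
      have : φ (xi α p.1) ^ 2 * (deriv φ (xi α p.1) * deriv h (xi α p.1) / φ (xi α p.1)) * N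
          = deriv φ (xi α p.1) * deriv h (xi α p.1) * φ (xi α p.1) * N := by
        field_simp
      linear_combination hB + this
    · rw [hbf]; simp
    · rw [hfb]; simp
    · rw [hff, Matrix.fromBlocks_apply₂₂, Matrix.smul_apply, smul_eq_mul, ← mul_assoc]
      congr 1
      have : φ (xi α p.1) ^ 2 * f (xi α p.1) * deriv f (xi α p.1) * deriv h (xi α p.1) * N
          = N * (φ (xi α p.1) ^ 2 / f (xi α p.1) * deriv f (xi α p.1) * deriv h (xi α p.1))
            * f (xi α p.1) ^ 2 := by
        field_simp
      rw [this]
      congr 1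
      linear_combination hF

end WarpedManifold

end WarpedYamabe

end

theorem theorem1p4 {n m : ℕ} (hn : 3 ≤ n) (hm : 1 ≤ m)
    {F : Type*} [TopologicalSpace F] [ChartedSpace (EuclideanSpace ℝ (Fin m)) F]
    [IsManifold (𝓡 m) ∞ F] [Nonempty F]
    (gF : TensorField (𝓡 m) F) (hgF : IsPseudoRiemannianMetric (stdBasis m) gF)
    (lamF : ℝ) (hlamF : ∀ y, scalarCurvature (stdBasis m) gF y = lamF)
    (ε : Fin n → ℝ) (hε : ∀ i, ε i = 1 ∨ ε i = -1)
    (α : Fin n → ℝ) (hα : α ≠ 0)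
    (f φ h : ℝ → ℝ) (hf : ContDiff ℝ ∞ f) (hφ : ContDiff ℝ ∞ φ) (hh : ContDiff ℝ ∞ h)
    (hfpos : ∀ t, 0 < f t) (hφne : ∀ t, φ t ≠ 0) (ρ : ℝ) :
    (∀ k₀ : Fin n, ∑ k, ε k * α k ^ 2 = ε k₀ →
      (IsGradientYamabeSoliton ((stdBasis n).prod (stdBasis m))
          (warpedMetric (conformalMetric ε (fun x => φ (xi α x))) (fun x => f (xi α x)) gF)
          (fun p : EuclideanSpace ℝ (Fin n) × F => h (xi α p.1)) ρ ↔
        ∀ t : ℝ,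
          deriv (deriv h) t + 2 * (deriv φ t * deriv h t / φ t) = 0 ∧
          ε k₀ * (((n : ℝ) - 1) * (2 * φ t * deriv (deriv φ) t - n * deriv φ t ^ 2)
              - 2 * (m / f t) * (φ t ^ 2 * deriv (deriv f) t
                  - ((n : ℝ) - 2) * φ t * deriv φ t * deriv f t)
              - m * ((m : ℝ) - 1) / f t ^ 2 * φ t ^ 2 * deriv f t ^ 2
              + deriv φ t * deriv h t * φ t) = ρ - lamF / f t ^ 2 ∧
          ε k₀ * (((n : ℝ) - 1) * (2 * φ t * deriv (deriv φ) t - n * deriv φ t ^ 2)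
              - 2 * (m / f t) * (φ t ^ 2 * deriv (deriv f) t
                  - ((n : ℝ) - 2) * φ t * deriv φ t * deriv f t)
              - m * ((m : ℝ) - 1) / f t ^ 2 * φ t ^ 2 * deriv f t ^ 2
              - φ t ^ 2 / f t * deriv f t * deriv h t) = ρ - lamF / f t ^ 2)) ∧
    (∑ k, ε k * α k ^ 2 = 0 →
      (IsGradientYamabeSoliton ((stdBasis n).prod (stdBasis m))
          (warpedMetric (conformalMetric ε (fun x => φ (xi α x))) (fun x => f (xi α x)) gF)
          (fun p : EuclideanSpace ℝ (Fin n) × F => h (xi α p.1)) ρ ↔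
        ∀ t : ℝ,
          deriv (deriv h) t + 2 * (deriv φ t * deriv h t / φ t) = 0 ∧
          ρ - lamF / f t ^ 2 = 0)) := by
  have hf0 : ∀ t, f t ≠ 0 := fun t => (hfpos t).ne'
  constructor
  · intro k₀ hk₀
    exact isGradientYamabeSoliton_iff (by omega) hm hgF hlamF hε hα hf hφ hh hf0 hφne ρ hk₀
  · intro hnull
    rw [isGradientYamabeSoliton_iff (by omega) hm hgF hlamF hε hα hf hφ hh hf0 hφne ρ hnull]
    refine forall_congr' fun t => and_congr_right fun _ => ?_
    simp only [zero_mul, and_self]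
    exact eq_comm
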